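/- Let $d\in\{2,3\}$ and let $\Omega\subset\mathbb R^d$ be a bounded, connected, open set with boundary $\Gamma$, and let $\mathcal T_h$ be a finite partition of $\Omega$ into (open, connected) polygons/polyhedra $T$ of arbitrary shape, with set $\mathcal E_h$ of (flat, closed) edges/faces: the elements are pairwise disjoint, $\overline\Omega=\bigcup_T\overline T$, the relative interiors of the edges/faces are pairwise disjoint, the boundary $\partial T$ of each element is the union of the $e\in\mathcal E_h$ with $e\subset\partial T$, each $e\in\mathcal E_h$ lies on the boundary of some element, and each element lies locally on one side of each of its edges/faces. Let $h_T$ be the diameter of $T$ and $\mathbf n$ the unit outward normal on $\partial T$. Let $\omega\neq0$ be a real constant. Let the conductivity $\sigma$ be real-valued, constant on each element and positive, and let $\varepsilon$ and $\mu$ be constant on each element with real symmetric positive definite values. Let $k\ge1$. All inner products are those of complex $L^2$: $(u,w)_T=\int_T u\cdot\overline w$, $\langle u,w\rangle_{\partial T}=\int_{\partial T}u\cdot\overline w$, $(\cdot,\cdot)=\sum_T(\cdot,\cdot)_T$. For $d=3$, $\times$ and $\nabla\times$ have the usual meaning. For $d=2$, a plane field $\mathbf v$ has scalar curl $\nabla\times\mathbf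 v=\partial_1v_2-\partial_2v_1$ and scalar product $\mathbf v\times\mathbf n=v_1n_2-v_2n_1$, and a scalar $\varphi$ has curl $\nabla\times\varphi=(\partial_2\varphi,-\partial_1\varphi)$. Put $c=3$ if $d=3$ and $c=1$ if $d=2$, so that curls of $d$-component fields have $c$ components. A coefficient that multiplies curls is a $c\times c$ matrix, and a coefficient that multiplies fields is a $d\times d$ matrix: for $d=3$ all are $3\times3$; for $d=2$, $\varepsilon$ is $2\times 2$ and $\mu$ scalar in system (E) below, and $\mu$ is $2\times2$ and $\varepsilon$ scalar in system (H). Let $\mathbf V_h$ be the space of $\mathbf v=\{\mathbf v_0,\mathbf v_b\}$ with $\mathbf v_0|_T\in[P_k(T)]^d$ for every $T\in\mathcal T_h$ and $\mathbf v_b|_e\in[P_k(e)]^d$, single-valued, for every $e\in\mathcal E_h$, where $P_r$ denotes the polynomials with complex coefficients of degree at most $r$. Let $$\mathbf V_{h,0}^1=\{\mathbf v\in\mathbf V_h:\mathbf v_b\times\mathbf n=0\text{ on }\Gamma\},\qquad \mathbf V_{h,0}^2=\{\mathbf v\in\mathbf V_h:\mathbf v_b\cdot\mathbf n=0\text{ on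 }\Gamma\},$$ where the conditions are imposed on the edges/faces contained in $\Gamma$. Let $W_h^1$ be the space of $q$ with $q|_T\in P_{k-1}(T)$ for every $T$, and $W_h^2=\{q\in W_h^1:\int_\Omega q=0\}$. For $\mathbf v\in\mathbf V_h$ and $\kappa\in\{\varepsilon,\mu\}$, let $\nabla_w\cdot(\kappa\mathbf v)|_T\in P_{k-1}(T)$ and $\nabla_w\times\mathbf v|_T\in[P_{k-1}(T)]^{c}$ be the unique polynomials with $$(\nabla_w\cdot(\kappa\mathbf v),\varphi)_T=-(\kappa\mathbf v_0,\nabla\varphi)_T+\langle\mathbf v_b\cdot\mathbf n,\varphi\rangle_{\partial T}\quad\forall\varphi\in P_{k-1}(T),$$ $$(\nabla_w\times\mathbf v,\varphi)_T=(\mathbf v_0,\nabla\times\varphi)_T-\langle\mathbf v_b\times\mathbf n,\varphi\rangle_{\partial T}\quad\forall\varphi\in[P_{k-1}(T)]^{c}.$$ Put $b_\kappa(\mathbf v,q)=\sum_T(\nabla_w\cdot(\kappa\mathbf v),q)_T$, $$s_\kappa(\mathbf v,\mathbf w)=\sum_Th_T^{-1}\big(\langle(\kappa\mathbf v_0-\mathbf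 v_b)\cdot\mathbf n,(\kappa\mathbf w_0-\mathbf w_b)\cdot\mathbf n\rangle_{\partial T}+\langle(\mathbf v_0-\mathbf v_b)\times\mathbf n,(\mathbf w_0-\mathbf w_b)\times\mathbf n\rangle_{\partial T}\big),$$ $b_1=b_\varepsilon$, $b_2=b_\mu$, and $$a_1(\mathbf v,\mathbf w)=\sum_T\big[(\mu^{-1}\nabla_w\times\mathbf v,\nabla_w\times\mathbf w)_T+((i\omega\sigma-\omega^2\varepsilon)\mathbf v_0,\mathbf w_0)_T\big]+s_\varepsilon(\mathbf v,\mathbf w),$$ $$a_2(\mathbf v,\mathbf w)=\sum_T\big[((i\omega\varepsilon+\sigma)^{-1}\nabla_w\times\mathbf v,\nabla_w\times\mathbf w)_T+(i\omega\mu\mathbf v_0,\mathbf w_0)_T\big]+s_\mu(\mathbf v,\mathbf w).$$ (E) For all $\mathbf j_e\in[L^2(\Omega)]^d$ and $\rho\in L^2(\Omega)$ there is exactly one pair $(\mathbf E_h,p_h)\in\mathbf V_{h,0}^1\times W_h^1$ such that $$a_1(\mathbf E_h,\mathbf v)-\overline{b_1(\mathbf v,p_h)}=-(i\omega\mathbf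 j_e,\mathbf v_0)\quad\forall\mathbf v\in\mathbf V_{h,0}^1,\qquad b_1(\mathbf E_h,w)=(\rho,w)\quad\forall w\in W_h^1.$$ (H) For every $\mathbf j_e\in[L^2(\Omega)]^{c}$ such that the distributional curl $\nabla\times\big((i\omega\varepsilon+\sigma)^{-1}\mathbf j_e\big)$ lies in $[L^2(\Omega)]^d$ there is exactly one pair $(\mathbf H_h,p_h)\in\mathbf V_{h,0}^2\times W_h^2$ such that $$a_2(\mathbf H_h,\mathbf v)-\overline{b_2(\mathbf v,p_h)}=\big(\nabla\times(i\omega\varepsilon+\sigma)^{-1}\mathbf j_e,\mathbf v_0\big)\quad\forall\mathbf v\in\mathbf V_{h,0}^2,\qquad b_2(\mathbf H_h,w)=0\quad\forall w\in W_h^2.$$ -/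

import Mathlib

open MeasureTheory
open scoped BigOperators

namespace WGMaxwell

noncomputable section

/-- `d`-dimensional Euclidean space. -/
abbrev Space (d : ℕ) : Type := EuclideanSpace ℝ (Fin d)

/-! ### Cross products and curls in two and three dimensions

For `d = 3` these are the usual ones.  For `d = 2` a plane field is identified with a field in space
that has no third component and does not depend on the third variable; its cross products and its
curl then have a third component only, so they are scalars, and the curl of a scalar
`φ` is the plane field `(∂₂φ, -∂₁φ)`.  (Nothing is claimed for other `d`.) -/

/-- The number of components of the curl of a vector field on `ℝ^d`. -/
def curlDim : ℕ → ℕ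
  | 2 => 1
  | 3 => 3
  | _ => 0

/-- The cross product `v × w`. -/
def cross : (d : ℕ) → (Fin d → ℂ) → (Fin d → ℂ) → (Fin (curlDim d) → ℂ)
  | 2, v, w => ![v 0 * w 1 - v 1 * w 0]
  | 3, v, w => ![v 1 * w 2 - v 2 * w 1, v 2 * w 0 - v 0 * w 2, v 0 * w 1 - v 1 * w 0]
  | _, _, _ => fun _ => 0

/-- Polynomial functions on `ℝ^d` with complex coefficients. -/
abbrev Poly (d : ℕ) : Type := MvPolynomial (Fin d) ℂ

/-- The curl of a polynomial field with `curlDim d` components, a field with `d` components. -/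
def polyCurl : (d : ℕ) → (Fin (curlDim d) → Poly d) → (Fin d → Poly d)
  | 2, φ =>
    let f : Fin 1 → Poly 2 := φ
    ![MvPolynomial.pderiv 1 (f 0), -MvPolynomial.pderiv 0 (f 0)]
  | 3, φ =>
    let f : Fin 3 → Poly 3 := φ
    ![MvPolynomial.pderiv 1 (f 2) - MvPolynomial.pderiv 2 (f 1),
      MvPolynomial.pderiv 2 (f 0) - MvPolynomial.pderiv 0 (f 2),
      MvPolynomial.pderiv 0 (f 1) - MvPolynomial.pderiv 1 (f 0)]
  | _, _ => fun _ => 0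

/-- The partial derivative `∂_i ψ_j` of a vector field `ψ` on `ℝ^d`. -/
def partialDeriv {d : ℕ} (ψ : Space d → Fin d → ℝ) (i j : Fin d) (x : Space d) : ℝ :=
  fderiv ℝ (fun y => ψ y j) x (EuclideanSpace.single i 1)

/-- The curl of a differentiable vector field with `d` components, with `curlDim d` components. -/
def fieldCurl : (d : ℕ) → (Space d → Fin d → ℝ) → Space d → (Fin (curlDim d) → ℝ)
  | 2, ψ, x => ![partialDeriv ψ 0 1 x - partialDeriv ψ 1 0 x]
  | 3, ψ, x => ![partialDeriv ψ 1 2 x - partialDeriv ψ 2 1 x,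
      partialDeriv ψ 2 0 x - partialDeriv ψ 0 2 x,
      partialDeriv ψ 0 1 x - partialDeriv ψ 1 0 x]
  | _, _, _ => fun _ => 0

/-- `g = ∇ × f` in `Ω` in the sense of distributions, for `f` with `curlDim d` components. -/
def IsDistribCurl {d : ℕ} (Ω : Set (Space d)) (f : Space d → Fin (curlDim d) → ℂ)
    (g : Space d → Fin d → ℂ) : Prop :=
  ∀ ψ : Space d → Fin d → ℝ, ContDiff ℝ (⊤ : ℕ∞) ψ → HasCompactSupport ψ → tsupport ψ ⊆ Ω →
    ∫ x in Ω, ∑ a, f x a * (fieldCurl d ψ x a : ℂ) = ∫ x in Ω, ∑ i, g x i * (ψ x i : ℂ)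

/-! ### Finite element partitions into polygons and polyhedra -/

/-- `e` is a flat, connected polytopal piece of dimension `d - 1`: a segment if `d = 2`, a plane
polygonal region if `d = 3`. -/
structure IsFlatFace {d : ℕ} (e : Set (Space d)) : Prop where
  isCompact : IsCompact e
  finrank_direction : Module.finrank ℝ (affineSpan ℝ e).direction + 1 = d
  isConnected : IsConnected (intrinsicInterior ℝ e)
  subset_closure : e ⊆ closure (intrinsicInterior ℝ e)
  polytopal : ∃ S : Finset (AffineSubspace ℝ (Space d)),
    (∀ A ∈ S, Module.finrank ℝ A.direction + 2 ≤ d) ∧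
      intrinsicFrontier ℝ e ⊆ ⋃ A ∈ S, (A : Set (Space d))

/-- `n` is the unit outward normal to the open set `T` along the face `e` of `T`: at each
relatively interior point `x` of `e`, the set `T` agrees near `x` with the half space
`{y | (y - x) ⬝ n < 0}`. -/
structure IsOutwardNormal {d : ℕ} (T e : Set (Space d)) (n : Space d) : Prop where
  norm_eq_one : ‖n‖ = 1
  halfSpace : ∀ x ∈ intrinsicInterior ℝ e, ∃ r > 0, ∀ y ∈ Metric.ball x r,
    (y ∈ T ↔ inner ℝ (y - x) n < 0)

/-- A partition of `Ω` into open polygons (`d = 2`) or polyhedra (`d = 3`) of arbitrary shape,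
with its set of edges/faces. -/
structure Mesh (d : ℕ) (Ω : Set (Space d)) where
  /-- the elements -/
  elems : Finset (Set (Space d))
  /-- the edges (`d = 2`) or faces (`d = 3`), as closed sets -/
  faces : Finset (Set (Space d))
  elem_isOpen : ∀ T ∈ elems, IsOpen T
  elem_isConnected : ∀ T ∈ elems, IsConnected T
  elem_subset : ∀ T ∈ elems, T ⊆ Ω
  elem_disjoint : ∀ T ∈ elems, ∀ T' ∈ elems, T ≠ T' → Disjoint T T'
  closure_eq : closure Ω = ⋃ T ∈ elems, closure T
  face_flat : ∀ e ∈ faces, IsFlatFace e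
  face_disjoint : ∀ e ∈ faces, ∀ e' ∈ faces, e ≠ e' →
    Disjoint (intrinsicInterior ℝ e) (intrinsicInterior ℝ e')
  face_of_elem : ∀ e ∈ faces, ∃ T ∈ elems, e ⊆ frontier T
  frontier_eq : ∀ T ∈ elems, frontier T = ⋃ e ∈ faces, ⋃ (_ : e ⊆ frontier T), e
  /-- the unit outward normal to an element along one of its faces -/
  normal : Set (Space d) → Set (Space d) → Space d
  normal_spec : ∀ T ∈ elems, ∀ e ∈ faces, e ⊆ frontier T → IsOutwardNormal T e (normal T e)

variable {d : ℕ} {Ω : Set (Space d)}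

open Classical in
/-- The edges/faces of the element `T`. -/
def Mesh.facesOf (M : Mesh d Ω) (T : M.elems) : Finset M.faces :=
  Finset.univ.filter fun e => (e : Set (Space d)) ⊆ frontier (T : Set (Space d))

/-- The unit outward normal of `T` along `e`, as a complex vector. -/
def Mesh.nrm (M : Mesh d Ω) (T : M.elems) (e : M.faces) : Fin d → ℂ :=
  fun i => ((M.normal T e i : ℝ) : ℂ)

/-- The surface measure on an edge/face `e`. -/
def surf (e : Set (Space d)) : Measure e :=
  Measure.comap Subtype.val (μHE[d - 1] : Measure (Space d))

/-! ### Polynomials and weak finite element functions -/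

/-- Polynomials of total degree at most `r`. -/
abbrev P (d r : ℕ) : Submodule ℂ (Poly d) := MvPolynomial.restrictTotalDegree (Fin d) ℂ r

/-- The value of a polynomial at a point of `ℝ^d`. -/
def ev (p : Poly d) (x : Space d) : ℂ := MvPolynomial.eval (fun i => ((x i : ℝ) : ℂ)) p

/-- The value of a polynomial vector field at a point of `ℝ^d`. -/
def evVec {m : ℕ} (p : Fin m → Poly d) (x : Space d) : Fin m → ℂ := fun i => ev (p i) x

/-- `f ∈ P_r(e)`: the function `f` on `e` is the restriction of a polynomial of degree at most
`r`. -/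
def IsPolyOn (e : Set (Space d)) (r : ℕ) (f : e → ℂ) : Prop :=
  ∃ p ∈ P d r, ∀ x : e, f x = ev p x

/-- Pairs `v = {v₀, v_b}`: on each element a polynomial vector field `v₀`, on each edge/face one
vector-valued function `v_b`, common to the elements that share the edge/face. -/
abbrev WeakFun (M : Mesh d Ω) : Type :=
  ((T : M.elems) → Fin d → Poly d) ×
    ((e : M.faces) → Fin d → ↥(e : Set (Space d)) → ℂ)

/-- The value of `v_b` at a point of the edge/face `e`. -/
def bdVal {M : Mesh d Ω} (v : WeakFun M) (e : M.faces) (x : ↥(e : Set (Space d))) : Fin d → ℂ :=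
  fun i => v.2 e i x

/-- The global weak finite element space `V_h` of order `k`. -/
def Vh (M : Mesh d Ω) (k : ℕ) : Set (WeakFun M) :=
  {v | (∀ (T : M.elems) (i : Fin d), v.1 T i ∈ P d k) ∧ ∀ (e : M.faces) (i : Fin d), IsPolyOn (e : Set (Space d)) k (v.2 e i)}

/-- `V_{h,0}^1`: functions in `V_h` with `v_b × n = 0` on `Γ = ∂Ω`. -/
def Vh1 (M : Mesh d Ω) (k : ℕ) : Set (WeakFun M) :=
  {v | v ∈ Vh M k ∧ ∀ T, ∀ e ∈ M.facesOf T, (e : Set (Space d)) ⊆ frontier Ω →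
    ∀ x, cross d (bdVal v e x) (M.nrm T e) = 0}

/-- `V_{h,0}^2`: functions in `V_h` with `v_b ⬝ n = 0` on `Γ = ∂Ω`. -/
def Vh2 (M : Mesh d Ω) (k : ℕ) : Set (WeakFun M) :=
  {v | v ∈ Vh M k ∧ ∀ T, ∀ e ∈ M.facesOf T, (e : Set (Space d)) ⊆ frontier Ω →
    ∀ x, bdVal v e x ⬝ᵥ M.nrm T e = 0}

/-- `W_h^1`: piecewise polynomials of degree at most `k - 1`. -/
def Wh1 (M : Mesh d Ω) (k : ℕ) : Set (M.elems → Poly d) :=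
  {q | ∀ T, q T ∈ P d (k - 1)}

/-- `W_h^2`: piecewise polynomials of degree at most `k - 1` with mean value zero over `Ω`. -/
def Wh2 (M : Mesh d Ω) (k : ℕ) : Set (M.elems → Poly d) :=
  {q | q ∈ Wh1 M k ∧ ∑ T : M.elems, ∫ x in (T : Set (Space d)), ev (q T) x = 0}

/-! ### Discrete weak divergence and discrete weak curl

All `L²` inner products are Hermitian: `(u, w) = ∫ u ⬝ w̄`. -/

/-- A real matrix as a complex matrix. -/
abbrev toC {m : ℕ} (A : Matrix (Fin m) (Fin m) ℝ) : Matrix (Fin m) (Fin m) ℂ :=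
  A.map fun t => (t : ℂ)

/-- The discrete weak divergence `∇_{w,r,T} ⬝ (κ v)`: the unique `g ∈ P_r(T)` with
`(g, φ)_T = -(κ v₀, ∇φ)_T + ⟨v_b ⬝ n, φ⟩_{∂T}` for all `φ ∈ P_r(T)`. -/
def weakDiv (M : Mesh d Ω) (r : ℕ) (κ : M.elems → Matrix (Fin d) (Fin d) ℝ) (v : WeakFun M)
    (T : M.elems) : Poly d :=
  Classical.epsilon fun g => g ∈ P d r ∧ ∀ φ ∈ P d r,
    ∫ x in (T : Set (Space d)), ev g x * star (ev φ x) =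
      -(∫ x in (T : Set (Space d)), (toC (κ T)).mulVec (evVec (v.1 T) x) ⬝ᵥ
          star (evVec (fun i => MvPolynomial.pderiv i φ) x))
      + ∑ e ∈ M.facesOf T, ∫ x : (e : Set (Space d)),
          (bdVal v e x ⬝ᵥ M.nrm T e) * star (ev φ x) ∂(surf (e : Set (Space d)))

/-- The discrete weak curl `∇_{w,r,T} × v`: the unique polynomial field `g` of degree at most `r`
with `(g, φ)_T = (v₀, ∇ × φ)_T - ⟨v_b × n, φ⟩_{∂T}` for all polynomial fields `φ` of degree at
most `r`. -/
def weakCurl (M : Mesh d Ω) (r : ℕ) (v : WeakFun M) (T : M.elems) : Fin (curlDim d) → Poly d :=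
  Classical.epsilon fun g => (∀ a, g a ∈ P d r) ∧
    ∀ φ : Fin (curlDim d) → Poly d, (∀ a, φ a ∈ P d r) →
      ∫ x in (T : Set (Space d)), evVec g x ⬝ᵥ star (evVec φ x) =
        (∫ x in (T : Set (Space d)), evVec (v.1 T) x ⬝ᵥ star (evVec (polyCurl d φ) x))
        - ∑ e ∈ M.facesOf T, ∫ x : (e : Set (Space d)),
            cross d (bdVal v e x) (M.nrm T e) ⬝ᵥ star (evVec φ x) ∂(surf (e : Set (Space d)))

/-! ### The sesquilinear forms -/

/-- The stabilizer `s_1` (for `κ = ε`) or `s_2` (for `κ = μ`). -/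
def stab (M : Mesh d Ω) (κ : M.elems → Matrix (Fin d) (Fin d) ℝ) (v w : WeakFun M) : ℂ :=
  ∑ T : M.elems, ((Metric.diam (T : Set (Space d)))⁻¹ : ℂ) *
    ∑ e ∈ M.facesOf T,
      ((∫ x : (e : Set (Space d)),
          (((toC (κ T)).mulVec (evVec (v.1 T) x) - bdVal v e x) ⬝ᵥ M.nrm T e) *
            star (((toC (κ T)).mulVec (evVec (w.1 T) x) - bdVal w e x) ⬝ᵥ M.nrm T e)
          ∂(surf (e : Set (Space d))))
      + ∫ x : (e : Set (Space d)),
          cross d (evVec (v.1 T) x - bdVal v e x) (M.nrm T e) ⬝ᵥ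
            star (cross d (evVec (w.1 T) x - bdVal w e x) (M.nrm T e))
          ∂(surf (e : Set (Space d))))

/-- `∑_T (A ∇_w × v, ∇_w × w)_T + (B v₀, w₀)_T` for piecewise constant complex matrices `A`,
`B`; the discrete weak curls have degree `k - 1`. -/
def bulk (M : Mesh d Ω) (k : ℕ)
    (A : M.elems → Matrix (Fin (curlDim d)) (Fin (curlDim d)) ℂ)
    (B : M.elems → Matrix (Fin d) (Fin d) ℂ) (v w : WeakFun M) : ℂ :=
  ∑ T : M.elems,
    ((∫ x in (T : Set (Space d)),
        (A T).mulVec (evVec (weakCurl M (k - 1) v T) x) ⬝ᵥ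
          star (evVec (weakCurl M (k - 1) w T) x))
    + ∫ x in (T : Set (Space d)), (B T).mulVec (evVec (v.1 T) x) ⬝ᵥ star (evVec (w.1 T) x))

/-- The form `a_1`. -/
def a1 (M : Mesh d Ω) (k : ℕ) (ω : ℝ) (σ : M.elems → ℝ)
    (ε : M.elems → Matrix (Fin d) (Fin d) ℝ)
    (μ : M.elems → Matrix (Fin (curlDim d)) (Fin (curlDim d)) ℝ) (v w : WeakFun M) : ℂ :=
  bulk M k (fun T => (toC (μ T))⁻¹)
    (fun T => (Complex.I * (ω : ℂ) * (σ T : ℂ)) • (1 : Matrix (Fin d) (Fin d) ℂ)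
      - ((ω : ℂ) ^ 2) • toC (ε T)) v w
  + stab M ε v w

/-- The complex matrix `(i ω ε + σ)⁻¹`. -/
def admInv {m : ℕ} (ω σ : ℝ) (ε : Matrix (Fin m) (Fin m) ℝ) : Matrix (Fin m) (Fin m) ℂ :=
  ((Complex.I * (ω : ℂ)) • toC ε + (σ : ℂ) • (1 : Matrix (Fin m) (Fin m) ℂ))⁻¹

/-- The form `a_2`. -/
def a2 (M : Mesh d Ω) (k : ℕ) (ω : ℝ) (σ : M.elems → ℝ)
    (ε : M.elems → Matrix (Fin (curlDim d)) (Fin (curlDim d)) ℝ)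
    (μ : M.elems → Matrix (Fin d) (Fin d) ℝ) (v w : WeakFun M) : ℂ :=
  bulk M k (fun T => admInv ω (σ T) (ε T))
    (fun T => (Complex.I * (ω : ℂ)) • toC (μ T)) v w
  + stab M μ v w

/-- The form `b_1` (for `κ = ε`) or `b_2` (for `κ = μ`):
`b(v, q) = ∑_T (∇_w ⬝ (κ v), q)_T`, with discrete weak divergences of degree `k - 1`. -/
def bForm (M : Mesh d Ω) (k : ℕ) (κ : M.elems → Matrix (Fin d) (Fin d) ℝ) (v : WeakFun M)
    (q : M.elems → Poly d) : ℂ :=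
  ∑ T : M.elems, ∫ x in (T : Set (Space d)), ev (weakDiv M (k - 1) κ v T) x * star (ev (q T) x)

/-- The inner product over `Ω` of a vector field `f` with the interior part `v₀` of `v`. -/
def loadVec (M : Mesh d Ω) (f : Space d → Fin d → ℂ) (v : WeakFun M) : ℂ :=
  ∑ T : M.elems, ∫ x in (T : Set (Space d)), f x ⬝ᵥ star (evVec (v.1 T) x)

/-- The inner product over `Ω` of a scalar function with a piecewise polynomial. -/
def loadScalar (M : Mesh d Ω) (ρ : Space d → ℂ) (q : M.elems → Poly d) : ℂ :=
  ∑ T : M.elems, ∫ x in (T : Set (Space d)), ρ x * star (ev (q T) x)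

open Classical in
/-- The product `A j` of a piecewise constant matrix `A` and a vector field `j`, defined in the
union of the (open) elements, hence almost everywhere in `Ω`. -/
def pwMul {m : ℕ} (M : Mesh d Ω) (A : M.elems → Matrix (Fin m) (Fin m) ℂ)
    (j : Space d → Fin m → ℂ) (x : Space d) : Fin m → ℂ :=
  ∑ T : M.elems, if x ∈ (T : Set (Space d)) then (A T).mulVec (j x) else 0

/-! ### The two weak Galerkin systems

With Hermitian inner products, the coupling term of the first equation of each system is
`(p_h, ∇_w ⬝ (κ v))`, the conjugate of `b(v, p_h)`, so that it is antilinear in the test function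
`v` and linear in the unknown `p_h`. -/

/-- `(E_h, p_h)` solves the weak Galerkin system for the electric field intensity. -/
structure IsElectricSolution (M : Mesh d Ω) (k : ℕ) (ω : ℝ) (σ : M.elems → ℝ)
    (ε : M.elems → Matrix (Fin d) (Fin d) ℝ)
    (μ : M.elems → Matrix (Fin (curlDim d)) (Fin (curlDim d)) ℝ)
    (j : Space d → Fin d → ℂ) (ρ : Space d → ℂ)
    (E : WeakFun M) (p : M.elems → Poly d) : Prop where
  mem_V : E ∈ Vh1 M k
  mem_W : p ∈ Wh1 M k
  eq_field : ∀ v ∈ Vh1 M k,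
    a1 M k ω σ ε μ E v - star (bForm M k ε v p) =
      -loadVec M (fun x => (Complex.I * (ω : ℂ)) • j x) v
  eq_div : ∀ w ∈ Wh1 M k, bForm M k ε E w = loadScalar M ρ w

/-- `(H_h, p_h)` solves the weak Galerkin system for the magnetic field intensity; `g` is the
curl of `(i ω ε + σ)⁻¹ j_e`. -/
structure IsMagneticSolution (M : Mesh d Ω) (k : ℕ) (ω : ℝ) (σ : M.elems → ℝ)
    (ε : M.elems → Matrix (Fin (curlDim d)) (Fin (curlDim d)) ℝ)
    (μ : M.elems → Matrix (Fin d) (Fin d) ℝ)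
    (g : Space d → Fin d → ℂ)
    (H : WeakFun M) (p : M.elems → Poly d) : Prop where
  mem_V : H ∈ Vh2 M k
  mem_W : p ∈ Wh2 M k
  eq_field : ∀ v ∈ Vh2 M k,
    a2 M k ω σ ε μ H v - star (bForm M k μ v p) = loadVec M g v
  eq_div : ∀ w ∈ Wh2 M k, bForm M k μ H w = 0

end

end WGMaxwell

namespace WGMaxwell

variable {d : ℕ} {Ω : Set (Space d)}

/-! ### Segments in general position -/

/-! Each system is a saddle point problem on finite-dimensional spaces with as many equations as
unknowns, so existence and uniqueness for all data follow once the homogeneous problem has only the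
zero solution (`IsSesqOn.existsUnique_saddle`).

For a homogeneous solution `(E, p)`, the second equation gives `b(E, p) = 0`, so testing the first
with `E` gives `a(E, E) = 0`. In system (E) the imaginary part is `ω ∑ σ ‖E₀‖²`, which forces `E₀ =
0`; the indefinite term with `-ω² ε` then disappears, and the real part makes the stabilizer vanish.
In system (H) the order is reversed: with `w = (iωε + σ)⁻¹ ∇_w × H`, the real part is `∑ σ ‖w‖²`
plus the stabilizer, so both vanish, and the imaginary part that remains is `ω ∑ (μ H₀, H₀)`. Either
way the interior part and the stabilizer are zero, so on every face the normal and tangential parts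
of `v_b` are zero (`eq_zero_of_a1_self`, `eq_zero_of_a2_self`).

There remains `b(v, p) = 0` for all test functions `v`. Taking `v = {∇p, 0}` shows that `p` is
constant on each element. Taking `v = {0, n}` on a single face shows that `p` does not jump there.
Since `Ω` is connected, `p` is one constant. In (E) a face belonging to only one element is also an
admissible support and forces the constant to be zero; in (H) the zero mean does
(`eq_zero_of_bForm_Vh1`, `eq_zero_of_bForm_Vh2`).

The geometric input is that elements can be linked through faces inside `Ω`, and that some face has
an element on one side only. Both are found along segments that avoid the finitely many subspaces of
codimension at least two containing the relative frontiers of the faces.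

Linearity is stated on submodules because the weak operators are chosen functions: off `V_h` the
face integrals may take their default value and linearity is not available. -/

theorem exists_mem_open_notMem_affineSubspaces {N : Finset (AffineSubspace ℝ (Space d))}
    (hN : ∀ A ∈ N, Module.finrank ℝ A.direction < d) {U : Set (Space d)} (hU : IsOpen U)
    (hne : U.Nonempty) : ∃ y ∈ U, ∀ A ∈ N, y ∉ A := by
  by_contra! h
  have h0 : volume (⋃ A ∈ N, (A : Set (Space d))) = 0 := by
    refine (measure_biUnion_null_iff N.countable_toSet).2 fun A hA => ?_
    refine Measure.addHaar_affineSubspace volume A fun htop => ?_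
    have := hN A hA
    rw [htop, AffineSubspace.direction_top, finrank_top, finrank_euclideanSpace_fin] at this
    exact lt_irrefl _ this
  refine (hU.measure_pos volume hne).ne' (measure_mono_null (fun y hy => ?_) h0)
  obtain ⟨A, hA, hyA⟩ := h y hy
  exact Set.mem_biUnion hA hyA

/-- The join of `y` with a space of codimension at least two is still a proper subspace, so some
`y'` in `U` avoids all the joins. A point of the line other than `y` lying in `A` would put `y'` in
the join of `y` and `A`. -/
theorem exists_segment_avoiding {N : Finset (AffineSubspace ℝ (Space d))}
    (hN : ∀ A ∈ N, Module.finrank ℝ A.direction + 2 ≤ d) {y : Space d} (hy : ∀ A ∈ N, y ∉ A)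
    {U : Set (Space d)} (hU : IsOpen U) (hne : U.Nonempty) :
    ∃ y' ∈ U, ∀ t : ℝ, ∀ A ∈ N, AffineMap.lineMap y y' t ∉ A := by
  classical
  let N' : Finset (AffineSubspace ℝ (Space d)) :=
    N.image fun A : AffineSubspace ℝ (Space d) => affineSpan ℝ (insert y (A : Set (Space d)))
  have hN' : ∀ B ∈ N', Module.finrank ℝ B.direction < d := by
    intro B hB
    obtain ⟨A, hA, rfl⟩ := Finset.mem_image.1 hB
    rw [direction_affineSpan]
    have := finrank_vectorSpan_insert_le A y
    have := hN A hA
    omega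
  obtain ⟨y', hy'U, hy'⟩ := exists_mem_open_notMem_affineSubspaces hN' hU hne
  refine ⟨y', hy'U, fun t A hA htA => ?_⟩
  have ht : t ≠ 0 := by
    rintro rfl
    rw [AffineMap.lineMap_apply_zero] at htA
    exact hy A hA htA
  refine hy' _ (Finset.mem_image_of_mem _ hA) ?_
  have h1 : y ∈ affineSpan ℝ (insert y (A : Set (Space d))) :=
    subset_affineSpan _ _ (Set.mem_insert _ _)
  have h2 : AffineMap.lineMap y y' t ∈ affineSpan ℝ (insert y (A : Set (Space d))) :=
    subset_affineSpan _ _ (Set.mem_insert_of_mem _ htA)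
  have h3 := AffineMap.lineMap_mem t⁻¹ h1 h2
  rwa [AffineMap.lineMap_lineMap_right, inv_mul_cancel₀ ht, AffineMap.lineMap_apply_one] at h3

/-! ### Elements sharing a face -/

theorem IsFlatFace.nonempty {e : Set (Space d)} (he : IsFlatFace e) : e.Nonempty :=
  he.isConnected.nonempty.mono intrinsicInterior_subset

/-- If two unit normals `n`, `n'` are not opposite, then `⟨n, n'⟩ > -1`, and a short step along `-(n
+ n')` enters both half spaces, hence two disjoint elements at once. -/
theorem Mesh.normal_eq_neg (M : Mesh d Ω) {T T' e : Set (Space d)} (hT : T ∈ M.elems)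
    (hT' : T' ∈ M.elems) (hne : T ≠ T') (he : e ∈ M.faces) (h : e ⊆ frontier T)
    (h' : e ⊆ frontier T') : M.normal T' e = -M.normal T e := by
  obtain ⟨x, hx⟩ := (M.face_flat e he).isConnected.nonempty
  have hn := M.normal_spec T hT e he h
  have hn' := M.normal_spec T' hT' e he h'
  set n := M.normal T e
  set n' := M.normal T' e
  obtain ⟨r, hr, hr'⟩ := hn.halfSpace x hx
  obtain ⟨s, hs, hs'⟩ := hn'.halfSpace x hx
  by_contra hnn
  have hi : -1 < inner ℝ n n' := by
    refine lt_of_le_of_ne ?_ fun heq => hnn ?_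
    · have := abs_real_inner_le_norm n n'
      rw [hn.norm_eq_one, hn'.norm_eq_one, one_mul] at this
      exact (abs_le.1 this).1
    · have := (inner_eq_neg_one_iff_of_norm_eq_one hn.norm_eq_one hn'.norm_eq_one).1 heq.symm
      rw [this, neg_neg]
  -- Since `n + n'` has norm at most 2, the factor 3 keeps the step inside both balls.
  obtain ⟨t, ht0, ht⟩ : ∃ t : ℝ, 0 < t ∧ t * 3 < min r s :=
    ⟨min r s / 4, by positivity, by have : 0 < min r s := by positivity
                                    linarith⟩
  have hsum : ‖n + n'‖ ≤ 2 := by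
    have := norm_add_le n n'
    rw [hn.norm_eq_one, hn'.norm_eq_one] at this
    linarith
  set y := x - t • (n + n')
  have hd : dist y x < min r s := by
    rw [dist_eq_norm, show y - x = -(t • (n + n')) by simp [y], norm_neg, norm_smul,
      Real.norm_of_nonneg ht0.le]
    nlinarith
  have hyx : y - x = -(t • (n + n')) := by simp [y]
  have hyT : y ∈ T := by
    refine (hr' y (hd.trans_le (min_le_left _ _))).2 ?_
    rw [hyx, inner_neg_left, inner_smul_left, inner_add_left, real_inner_self_eq_norm_sq,
      hn.norm_eq_one, real_inner_comm]
    simp only [RCLike.conj_to_real]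
    nlinarith
  have hyT' : y ∈ T' := by
    refine (hs' y (hd.trans_le (min_le_right _ _))).2 ?_
    rw [hyx, inner_neg_left, inner_smul_left, inner_add_left, real_inner_self_eq_norm_sq,
      hn'.norm_eq_one]
    simp only [RCLike.conj_to_real]
    nlinarith
  exact Set.disjoint_left.1 (M.elem_disjoint T hT T' hT' hne) hyT hyT'

/-- Three unit vectors cannot be pairwise opposite. -/
theorem Mesh.eq_or_eq_of_subset_frontier (M : Mesh d Ω) {T T' S e : Set (Space d)}
    (hT : T ∈ M.elems) (hT' : T' ∈ M.elems) (hS : S ∈ M.elems) (hne : T ≠ T') (he : e ∈ M.faces)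
    (h : e ⊆ frontier T) (h' : e ⊆ frontier T') (hS' : e ⊆ frontier S) : S = T ∨ S = T' := by
  by_contra! hc
  have h1 := M.normal_eq_neg hT hT' hne he h h'
  have h2 := M.normal_eq_neg hT hS hc.1.symm he h hS'
  have h3 := M.normal_eq_neg hT' hS hc.2.symm he h' hS'
  have hn := (M.normal_spec T hT e he h).norm_eq_one
  rw [h2, h1, neg_neg] at h3
  have h4 : (2 : ℝ) • M.normal T e = 0 := by
    rw [two_smul]
    nth_rewrite 1 [← h3]
    exact neg_add_cancel _
  rw [(smul_eq_zero.1 h4).resolve_left two_ne_zero] at hn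
  simp at hn

/-- Finitely many subspaces of codimension two contain the relative frontiers of all faces. -/
theorem Mesh.exists_skeleton (M : Mesh d Ω) : ∃ N : Finset (AffineSubspace ℝ (Space d)),
    (∀ A ∈ N, Module.finrank ℝ A.direction + 2 ≤ d) ∧
    ∀ e ∈ M.faces, ∀ x ∈ e, (∀ A ∈ N, x ∉ A) → x ∈ intrinsicInterior ℝ e := by
  classical
  choose! S hS using fun e he => (M.face_flat e he).polytopal
  refine ⟨M.faces.biUnion S, fun A hA => ?_, fun e he x hx hxN => ?_⟩
  · obtain ⟨e, he, hA⟩ := Finset.mem_biUnion.1 hA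
    exact (hS e he).1 A hA
  · have : x ∈ intrinsicInterior ℝ e ∪ intrinsicFrontier ℝ e := by
      rw [intrinsicInterior_union_intrinsicFrontier]
      exact subset_intrinsicClosure hx
    refine this.resolve_right fun hf => ?_
    obtain ⟨A, hA, hxA⟩ := Set.mem_iUnion₂.1 ((hS e he).2 hf)
    exact hxN A (Finset.mem_biUnion.2 ⟨e, he, hA⟩) hxA

/-! ### Adjacency of elements across faces, and faces with one element -/

theorem Mesh.mem_frontier_of_mem_closure (M : Mesh d Ω) {T T' : Set (Space d)}
    (hT : T ∈ M.elems) (hT' : T' ∈ M.elems) (hne : T ≠ T') {x : Space d} (h : x ∈ closure T)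
    (h' : x ∈ closure T') : x ∈ frontier T' := by
  rw [(M.elem_isOpen T' hT').frontier_eq]
  refine ⟨h', fun hx => ?_⟩
  obtain ⟨y, hy, hy'⟩ := mem_closure_iff.1 h T' (M.elem_isOpen T' hT') hx
  exact Set.disjoint_left.1 (M.elem_disjoint T hT T' hT' hne) hy' hy

theorem Mesh.exists_face_of_mem_frontier (M : Mesh d Ω) {T : Set (Space d)} (hT : T ∈ M.elems)
    {x : Space d} (hx : x ∈ frontier T) : ∃ e ∈ M.faces, e ⊆ frontier T ∧ x ∈ e := by
  rw [M.frontier_eq T hT] at hx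
  simp only [Set.mem_iUnion] at hx
  obtain ⟨e, he, h, hx⟩ := hx
  exact ⟨e, he, h, hx⟩

/-- A quantity on the elements that does not change across the faces inside `Ω` is constant. -/
theorem Mesh.eq_of_forall_face_eq (M : Mesh d Ω) (hΩ : IsOpen Ω)
    (hconn : IsConnected Ω) {α : Type*} (c : M.elems → α)
    (hc : ∀ T T' : M.elems, T ≠ T' → ∀ e ∈ M.faces, e ⊆ frontier (T : Set (Space d)) →
      e ⊆ frontier (T' : Set (Space d)) → ¬e ⊆ frontier Ω → c T = c T') (T T' : M.elems) :
    c T = c T' := by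
  classical
  by_contra hTT
  obtain ⟨N, hN, hface⟩ := M.exists_skeleton
  let A : Set (Space d) := ⋃ S ∈ {S : M.elems | c S = c T}, closure (S : Set (Space d))
  let B : Set (Space d) := ⋃ S ∈ {S : M.elems | c S ≠ c T}, closure (S : Set (Space d))
  have hA : IsClosed A := (Set.toFinite _).isClosed_biUnion fun _ _ => isClosed_closure
  have hB : IsClosed B := (Set.toFinite _).isClosed_biUnion fun _ _ => isClosed_closure
  have hcov : Ω ⊆ A ∪ B := by
    intro x hx
    have := subset_closure hx
    rw [M.closure_eq] at this
    obtain ⟨S, hS, hxS⟩ := Set.mem_iUnion₂.1 this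
    by_cases h : c ⟨S, hS⟩ = c T
    · exact Or.inl (Set.mem_biUnion (show (⟨S, hS⟩ : M.elems) ∈ {S | c S = c T} from h) hxS)
    · exact Or.inr (Set.mem_biUnion (show (⟨S, hS⟩ : M.elems) ∈ {S | c S ≠ c T} from h) hxS)
  -- Off the skeleton, a common point of `A` and `B` is relatively interior to a face of each of two
  -- elements. Disjoint relative interiors make it the same face, and this face is not inside `Γ`
  -- because the point is in the open set `Ω`; so `hc` applies.
  have hgen : ∀ x ∈ Ω, x ∈ A → x ∈ B → ∃ D ∈ N, x ∈ D := by
    intro x hx hxA hxB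
    by_contra! hxN
    obtain ⟨S, hS, hxS⟩ := Set.mem_iUnion₂.1 hxA
    obtain ⟨S', hS', hxS'⟩ := Set.mem_iUnion₂.1 hxB
    have hne : S ≠ S' := by
      rintro rfl
      exact hS' hS
    have hne' : (S : Set (Space d)) ≠ S' := fun h => hne (Subtype.ext h)
    obtain ⟨e', he', hf', hxe'⟩ := M.exists_face_of_mem_frontier S'.2
      (M.mem_frontier_of_mem_closure S.2 S'.2 hne' hxS hxS')
    obtain ⟨e, he, hf, hxe⟩ := M.exists_face_of_mem_frontier S.2
      (M.mem_frontier_of_mem_closure S'.2 S.2 hne'.symm hxS' hxS)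
    have hee : e = e' := by
      by_contra hee
      exact Set.disjoint_left.1 (M.face_disjoint e he e' he' hee) (hface e he x hxe hxN)
        (hface e' he' x hxe' hxN)
    subst hee
    refine hS' ((hc S S' hne e he hf hf' fun hΓ => ?_).symm.trans hS)
    have := hΓ hxe
    rw [hΩ.frontier_eq] at this
    exact this.2 hx
  have hmemA : ∀ S : M.elems, c S = c T → (S : Set (Space d)) ⊆ A := fun S hS x hx =>
    Set.mem_biUnion (show S ∈ {S | c S = c T} from hS) (subset_closure hx)
  have hmemB : ∀ S : M.elems, c S ≠ c T → (S : Set (Space d)) ⊆ B := fun S hS x hx =>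
    Set.mem_biUnion (show S ∈ {S | c S ≠ c T} from hS) (subset_closure hx)
  obtain ⟨y0, hy0⟩ := (M.elem_isConnected T T.2).nonempty
  obtain ⟨y1, hy1⟩ := (M.elem_isConnected T' T'.2).nonempty
  obtain ⟨x, hx, hxA, hxB⟩ := isPreconnected_closed_iff.1 hconn.isPreconnected A B hA hB hcov
    ⟨y0, M.elem_subset T T.2 hy0, hmemA T rfl hy0⟩
    ⟨y1, M.elem_subset T' T'.2 hy1, hmemB T' (Ne.symm hTT) hy1⟩
  -- The common point `x` may lie on the skeleton. A generic segment near it, joining an element of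
  -- one class to an element of the other, meets `A ∩ B` off the skeleton.
  obtain ⟨r, hr, hball⟩ := Metric.isOpen_iff.1 hΩ x hx
  obtain ⟨S, hS, hxS⟩ := Set.mem_iUnion₂.1 hxA
  obtain ⟨S', hS', hxS'⟩ := Set.mem_iUnion₂.1 hxB
  obtain ⟨y, ⟨hyb, hyS⟩, hyN⟩ := exists_mem_open_notMem_affineSubspaces
    (fun A hA => lt_of_lt_of_le (Nat.lt_add_of_pos_right two_pos) (hN A hA))
    (Metric.isOpen_ball.inter (M.elem_isOpen S S.2))
    (mem_closure_iff.1 hxS _ Metric.isOpen_ball (Metric.mem_ball_self hr))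
  obtain ⟨y', ⟨hyb', hyS'⟩, hyN'⟩ := exists_segment_avoiding hN hyN
    (Metric.isOpen_ball.inter (M.elem_isOpen S' S'.2))
    (mem_closure_iff.1 hxS' _ Metric.isOpen_ball (Metric.mem_ball_self hr))
  have hseg : segment ℝ y y' ⊆ Ω := ((convex_ball x r).segment_subset hyb hyb').trans hball
  obtain ⟨z, hz, hzA, hzB⟩ := isPreconnected_closed_iff.1 (convex_segment y y').isPreconnected A B
    hA hB (hseg.trans hcov) ⟨y, left_mem_segment ℝ y y', hmemA S hS hyS⟩
    ⟨y', right_mem_segment ℝ y y', hmemB S' hS' hyS'⟩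
  obtain ⟨D, hD, hzD⟩ := hgen z (hseg hz) hzA hzB
  rw [segment_eq_image_lineMap] at hz
  obtain ⟨t, -, rfl⟩ := hz
  exact hyN' t D hD hzD

/-- Some face belongs to only one element. -/
theorem Mesh.exists_face_of_unique_elem (M : Mesh d Ω) (hd : 0 < d) (hbdd : Bornology.IsBounded Ω)
    (T : M.elems) : ∃ e ∈ M.faces, ∃ S ∈ M.elems, e ⊆ frontier S ∧
      ∀ S' ∈ M.elems, e ⊆ frontier S' → S' = S := by
  obtain ⟨N, hN, hface⟩ := M.exists_skeleton
  have : Nonempty (Fin d) := ⟨⟨0, hd⟩⟩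
  have hcpt : IsCompact (closure Ω) := hbdd.isCompact_closure
  obtain ⟨y, hyT, hyN⟩ := exists_mem_open_notMem_affineSubspaces
    (fun A hA => lt_of_lt_of_le (Nat.lt_add_of_pos_right two_pos) (hN A hA))
    (M.elem_isOpen T T.2) (M.elem_isConnected T T.2).nonempty
  obtain ⟨y', hy', hyN'⟩ := exists_segment_avoiding hN hyN isClosed_closure.isOpen_compl
    (Set.nonempty_compl.2 hcpt.ne_univ)
  let f : ℝ → Space d := fun t => AffineMap.lineMap y y' t
  have hf : Continuous f := AffineMap.lineMap_continuous
  have hK : IsCompact (Set.Icc (0 : ℝ) 1 ∩ f ⁻¹' closure Ω) :=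
    isCompact_Icc.inter_right (isClosed_closure.preimage hf)
  -- The last point of the segment in `closure Ω`. The closure matters: a face on `Γ` may be a slit
  -- with elements on both sides.
  obtain ⟨t, ⟨ht, htΩ⟩, hmax⟩ := hK.exists_isGreatest ⟨0, ⟨le_rfl, zero_le_one⟩, by
    simpa [f] using subset_closure (M.elem_subset T T.2 hyT)⟩
  have ht1 : t < 1 := lt_of_le_of_ne ht.2 (by
    rintro rfl
    exact hy' (by simpa [f] using htΩ))
  have hout : ∀ U : Set (Space d), IsOpen U → f t ∈ U → ¬U ⊆ closure Ω := by
    intro U hU hfU hUΩ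
    have h1 : ∀ᶠ s in nhdsWithin t (Set.Ioi t), f s ∈ U :=
      nhdsWithin_le_nhds (hf.continuousAt.eventually (hU.mem_nhds hfU))
    obtain ⟨s, hs, hsU⟩ := (Filter.Eventually.and (Ioo_mem_nhdsGT ht1) h1).exists
    exact hs.1.not_ge (hmax ⟨⟨ht.1.trans hs.1.le, hs.2.le⟩, hUΩ hsU⟩)
  have htΩ' : f t ∈ closure Ω := htΩ
  rw [M.closure_eq] at htΩ'
  obtain ⟨S, hS, htS⟩ := Set.mem_iUnion₂.1 htΩ'
  have htF : f t ∈ frontier S := by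
    rw [(M.elem_isOpen S hS).frontier_eq]
    exact ⟨htS, fun h => hout S (M.elem_isOpen S hS) h ((M.elem_subset S hS).trans subset_closure)⟩
  obtain ⟨e, he, hef, hte⟩ := M.exists_face_of_mem_frontier hS htF
  refine ⟨e, he, S, hS, hef, fun S' hS' hef' => ?_⟩
  by_contra hne
  have hint := hface e he (f t) hte (hyN' t)
  have hn := M.normal_spec S hS e he hef
  have hn' := M.normal_spec S' hS' e he hef'
  rw [M.normal_eq_neg hS hS' (Ne.symm hne) he hef hef'] at hn'
  obtain ⟨r, hr, hr'⟩ := hn.halfSpace _ hint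
  obtain ⟨s, hs, hs'⟩ := hn'.halfSpace _ hint
  -- With opposite normals, the two open half balls lie in `S` and `S'` and the disc between them in
  -- the closure of `S`, so a whole ball around the exit point would lie in `closure Ω`.
  refine hout (Metric.ball (f t) (min r s)) Metric.isOpen_ball
    (Metric.mem_ball_self (lt_min hr hs)) fun z hz => ?_
  have hzr : z ∈ Metric.ball (f t) r := Metric.ball_subset_ball (min_le_left _ _) hz
  have hzs : z ∈ Metric.ball (f t) s := Metric.ball_subset_ball (min_le_right _ _) hz
  rcases lt_trichotomy (inner ℝ (z - f t) (M.normal S e)) 0 with h | h | h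
  · exact subset_closure (M.elem_subset S hS ((hr' z hzr).2 h))
  · refine closure_mono (M.elem_subset S hS) (Metric.mem_closure_iff.2 fun δ hδ => ?_)
    have hzr' : 0 < r - dist z (f t) := sub_pos.2 hzr
    obtain ⟨a, ha0, ha⟩ : ∃ a : ℝ, 0 < a ∧ a < min δ (r - dist z (f t)) :=
      exists_between (lt_min hδ hzr')
    have hd1 : dist z (z - a • M.normal S e) = a := by
      rw [dist_eq_norm, sub_sub_cancel, norm_smul, hn.norm_eq_one, mul_one,
        Real.norm_of_nonneg ha0.le]
    refine ⟨z - a • M.normal S e, (hr' _ ?_).2 ?_, ?_⟩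
    · rw [Metric.mem_ball]
      have := dist_triangle_left (z - a • M.normal S e) (f t) z
      have := lt_of_lt_of_le ha (min_le_right _ _)
      linarith
    · rw [sub_right_comm, inner_sub_left, h, inner_smul_left, real_inner_self_eq_norm_sq,
        hn.norm_eq_one]
      simpa using ha0
    · rw [hd1]
      exact lt_of_lt_of_le ha (min_le_left _ _)
  · refine subset_closure (M.elem_subset S' hS' ((hs' z hzs).2 ?_))
    rw [inner_neg_right]
    linarith

/-! ### The surface measure on a face -/

theorem surf_apply {e : Set (Space d)} (he : IsCompact e) (U : Set e) :
    surf e U = (μHE[d - 1] : Measure (Space d)) (Subtype.val '' U) :=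
  (MeasurableEmbedding.subtype_coe he.isClosed.measurableSet).comap_apply _ _

/-- In the affine span of the face, Hausdorff measure of the matching dimension is Lebesgue measure
carried over by an isometry, and it is finite on compact sets. -/
theorem IsFlatFace.isFiniteMeasure_surf {e : Set (Space d)} (he : IsFlatFace e) :
    IsFiniteMeasure (surf e) := by
  refine ⟨?_⟩
  rw [surf_apply he.isCompact, Set.image_univ, Subtype.range_coe]
  obtain ⟨x, hx⟩ := he.nonempty
  let p : affineSpan ℝ e := ⟨x, subset_affineSpan ℝ e hx⟩
  have : Nonempty (affineSpan ℝ e) := ⟨p⟩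
  have hK : IsCompact (Subtype.val ⁻¹' e : Set (affineSpan ℝ e)) := by
    refine Topology.IsClosedEmbedding.isCompact_preimage ?_ he.isCompact
    exact (AffineSubspace.closed_of_finiteDimensional _).isClosedEmbedding_subtypeVal
  have himg : (Subtype.val '' (Subtype.val ⁻¹' e : Set (affineSpan ℝ e))) = e := by
    exact (Subtype.image_preimage_coe _ _).trans (Set.inter_eq_right.2 (subset_affineSpan ℝ e))
  have hemb (z : affineSpan ℝ e) : MeasurableEmbedding (IsometryEquiv.vaddConst z) :=
    (IsometryEquiv.vaddConst z).toHomeomorph.measurableEmbedding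
  have hdim : d - 1 = Module.finrank ℝ (affineSpan ℝ e).direction := by
    have := he.finrank_direction
    omega
  rw [← himg, AffineSubspace.euclideanHausdorffMeasure_coe_image, hdim,
    EuclideanGeometry.euclideanHausdorffMeasure_eq p,
    (hemb p).map_apply]
  exact ((IsometryEquiv.vaddConst p).toHomeomorph.isCompact_preimage.2 hK).measure_lt_top

/-- A nonempty relatively open part of the face meets the relative interior, hence contains a
nonempty open subset of the affine span. This lets vanishing face integrals of continuous
nonnegative functions give pointwise vanishing. -/
theorem IsFlatFace.isOpenPosMeasure_surf {e : Set (Space d)} (he : IsFlatFace e) :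
    (surf e).IsOpenPosMeasure := by
  refine ⟨fun U hU hne => ?_⟩
  rw [surf_apply he.isCompact]
  obtain ⟨O, hO, rfl⟩ := isOpen_induced_iff.1 hU
  obtain ⟨⟨x, hxe⟩, hxO⟩ := hne
  obtain ⟨-, hyO, z, hz, rfl⟩ := mem_closure_iff.1 (he.subset_closure hxe) O hO hxO
  have : Nonempty (affineSpan ℝ e) := ⟨z⟩
  let V : Set (affineSpan ℝ e) := interior (Subtype.val ⁻¹' e : Set (affineSpan ℝ e)) ∩ Subtype.val ⁻¹' O
  have hV : IsOpen V := isOpen_interior.inter (hO.preimage continuous_subtype_val)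
  have hsub : Subtype.val '' V ⊆ Subtype.val '' (Subtype.val ⁻¹' O : Set e) := by
    rintro - ⟨y, ⟨hy, hyO⟩, rfl⟩
    exact ⟨⟨y, (interior_subset hy : _)⟩, hyO, rfl⟩
  have hemb (z : affineSpan ℝ e) : MeasurableEmbedding (IsometryEquiv.vaddConst z) :=
    (IsometryEquiv.vaddConst z).toHomeomorph.measurableEmbedding
  have hdim : d - 1 = Module.finrank ℝ (affineSpan ℝ e).direction := by
    have := he.finrank_direction
    omega
  refine fun h0 => ?_
  have h1 := measure_mono_null hsub h0
  rw [AffineSubspace.euclideanHausdorffMeasure_coe_image, hdim,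
    EuclideanGeometry.euclideanHausdorffMeasure_eq z,
    (hemb z).map_apply] at h1
  refine (IsOpen.measure_pos volume (hV.preimage (IsometryEquiv.vaddConst z).continuous)
    ⟨0, ?_⟩).ne' h1
  simpa [V] using ⟨hz, hyO⟩

instance Mesh.isFiniteMeasure_surf (M : Mesh d Ω) (e : M.faces) :
    IsFiniteMeasure (surf (e : Set (Space d))) :=
  (M.face_flat e e.2).isFiniteMeasure_surf

instance Mesh.isOpenPosMeasure_surf (M : Mesh d Ω) (e : M.faces) :
    (surf (e : Set (Space d))).IsOpenPosMeasure :=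
  (M.face_flat e e.2).isOpenPosMeasure_surf

instance Mesh.compactSpace_face (M : Mesh d Ω) (e : M.faces) :
    CompactSpace (e : Set (Space d)) :=
  isCompact_iff_compactSpace.1 (M.face_flat e e.2).isCompact

theorem Mesh.integrable_surf (M : Mesh d Ω) (e : M.faces) {f : ↥(e : Set (Space d)) → ℂ}
    (hf : Continuous f) : Integrable f (surf (e : Set (Space d))) := by
  have := hf.continuousOn.integrableOn_compact (μ := surf (e : Set (Space d))) isCompact_univ
  rwa [integrableOn_univ] at this

theorem Mesh.integrableOn_elem (M : Mesh d Ω) (hbdd : Bornology.IsBounded Ω) (T : M.elems)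
    {f : Space d → ℂ} (hf : Continuous f) : IntegrableOn f (T : Set (Space d)) :=
  (hf.continuousOn.integrableOn_compact hbdd.isCompact_closure).mono_set
    ((M.elem_subset T T.2).trans subset_closure)

theorem Mesh.volume_elem_lt_top (M : Mesh d Ω) (hbdd : Bornology.IsBounded Ω) (T : M.elems) :
    volume (T : Set (Space d)) < ⊤ :=
  (hbdd.subset (M.elem_subset T T.2)).measure_lt_top

/-- Keeps the stabilizer weights positive: for diameter zero the inverse would be zero by convention
and the residuals would be lost. -/
theorem Mesh.diam_pos (M : Mesh d Ω) (hd : 0 < d) (hbdd : Bornology.IsBounded Ω) (T : M.elems) :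
    0 < Metric.diam (T : Set (Space d)) := by
  have : Nonempty (Fin d) := ⟨⟨0, hd⟩⟩
  refine Metric.diam_pos ?_ (hbdd.subset (M.elem_subset T T.2))
  obtain ⟨x, hx⟩ := (M.elem_isConnected T T.2).nonempty
  exact (infinite_of_mem_nhds x ((M.elem_isOpen T T.2).mem_nhds hx)).nontrivial

/-! ### Polynomials -/

/-- Evaluation of polynomials, as a linear map to functions. -/
noncomputable def evL (d : ℕ) : Poly d →ₗ[ℂ] Space d → ℂ where
  toFun p := ev p
  map_add' p q := funext fun x => by simp [ev]
  map_smul' c p := funext fun x => by simp [ev]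

@[fun_prop]
theorem continuous_ev (p : Poly d) : Continuous (ev p) := by
  unfold ev
  have := MvPolynomial.continuous_eval p
  exact this.comp (by fun_prop)

/-- The open set contains a product of real intervals, which are infinite subsets of `ℂ`; a complex
polynomial vanishing on such a product is zero. -/
theorem eq_zero_of_ev_eq_zero {p : Poly d} {U : Set (Space d)} (hU : IsOpen U)
    (hne : U.Nonempty) (h : ∀ x ∈ U, ev p x = 0) : p = 0 := by
  obtain ⟨x, hx⟩ := hne
  have hU' : (WithLp.toLp 2 ⁻¹' U : Set (Fin d → ℝ)) ∈ nhds (WithLp.ofLp x) := by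
    exact (hU.preimage (PiLp.continuous_toLp 2 _)).mem_nhds (by simpa using hx)
  obtain ⟨r, hr, hball⟩ := Metric.mem_nhds_iff.1 hU'
  refine MvPolynomial.funext_set (s := fun i => Complex.ofReal '' Metric.ball (x i) r)
    (fun i => ?_) fun y hy => ?_
  · refine Set.Infinite.image Complex.ofReal_injective.injOn ?_
    exact infinite_of_mem_nhds _ (Metric.ball_mem_nhds _ hr)
  · choose z hz hzy using fun i => hy i (Set.mem_univ i)
    have hzU : WithLp.toLp 2 z ∈ U := hball ((dist_pi_lt_iff hr).2 hz)
    have := h _ hzU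
    rw [map_zero, ← this, ev]
    congr 2
    funext i
    exact (hzy i).symm

/-- In characteristic zero, a nonconstant monomial with nonzero coefficient survives differentiation
in a variable that it contains. -/
theorem eq_C_of_pderiv_eq_zero {p : Poly d} (h : ∀ i, MvPolynomial.pderiv i p = 0) :
    p = MvPolynomial.C (MvPolynomial.coeff 0 p) := by
  classical
  ext m
  rw [MvPolynomial.coeff_C]
  split_ifs with hm
  · rw [hm]
  · obtain ⟨i, hi⟩ : ∃ i, m i ≠ 0 := by
      by_contra! h0
      exact hm (Finsupp.ext h0).symm
    have h1 := MvPolynomial.coeff_pderiv (i := i) p (m - Finsupp.single i 1)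
    rw [h i, MvPolynomial.coeff_zero, tsub_add_cancel_of_le] at h1
    · refine (mul_eq_zero.1 h1.symm).resolve_right ?_
      exact Nat.cast_add_one_ne_zero _
    · rw [Finsupp.single_le_iff]
      omega

theorem pderiv_mem_P {r : ℕ} {p : Poly d} (hp : p ∈ P d r) (i : Fin d) :
    MvPolynomial.pderiv i p ∈ P d r := by
  classical
  rw [MvPolynomial.mem_restrictTotalDegree] at hp ⊢
  refine Finset.sup_le fun m hm => ?_
  rw [MvPolynomial.mem_support_iff, MvPolynomial.coeff_pderiv] at hm
  have := MvPolynomial.le_totalDegree (MvPolynomial.mem_support_iff.2 (left_ne_zero_of_mul hm))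
  rw [Finsupp.sum_add_index' (fun _ => rfl) fun _ _ _ => rfl] at this
  exact (Nat.le_add_right _ _).trans (this.trans hp)

/-! ### Linear, antilinear and sesquilinear functions on submodules -/

section Sesquilinear

variable {V W X Y : Type*} [AddCommGroup V] [Module ℂ V] [AddCommGroup W] [Module ℂ W]
  [AddCommGroup X] [Module ℂ X] [AddCommGroup Y] [Module ℂ Y]

/-- `f` is linear on the submodule `S`. -/
structure IsLinOn (S : Submodule ℂ V) (f : V → X) : Prop where
  add : ∀ v ∈ S, ∀ v' ∈ S, f (v + v') = f v + f v'
  smul : ∀ (c : ℂ), ∀ v ∈ S, f (c • v) = c • f v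

/-- `f` is antilinear on the submodule `S`. -/
structure IsAntilinOn (S : Submodule ℂ V) (f : V → ℂ) : Prop where
  add : ∀ v ∈ S, ∀ v' ∈ S, f (v + v') = f v + f v'
  smul : ∀ (c : ℂ), ∀ v ∈ S, f (c • v) = star c * f v

/-- `f` is sesquilinear on `S × R`, antilinear in the second variable. -/
structure IsSesqOn (S : Submodule ℂ V) (R : Submodule ℂ W) (f : V → W → ℂ) : Prop where
  left : ∀ w ∈ R, IsLinOn S fun v => f v w
  right : ∀ v ∈ S, IsAntilinOn R (f v)

variable {S : Submodule ℂ V} {R : Submodule ℂ W} {Q : Submodule ℂ X}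

theorem isLinOn_linearMap (f : V →ₗ[ℂ] X) (S : Submodule ℂ V) : IsLinOn S f :=
  ⟨fun _ _ _ _ => map_add _ _ _, fun _ _ _ => map_smul _ _ _⟩

theorem IsLinOn.linearMap_comp {f : V → X} (hf : IsLinOn S f) (g : X →ₗ[ℂ] Y) :
    IsLinOn S fun v => g (f v) :=
  ⟨fun v hv v' hv' => by rw [hf.add v hv v' hv', map_add],
    fun c v hv => by rw [hf.smul c v hv, map_smul]⟩

theorem IsSesqOn.dot {m : ℕ} {F : V → Fin m → ℂ} {G : W → Fin m → ℂ} (hF : IsLinOn S F)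
    (hG : IsLinOn R G) : IsSesqOn S R fun v w => F v ⬝ᵥ star (G w) where
  left w _ := ⟨fun v hv v' hv' => by simp only [hF.add v hv v' hv', add_dotProduct],
    fun c v hv => by simp only [hF.smul c v hv, smul_dotProduct]⟩
  right v _ := ⟨fun w hw w' hw' => by rw [hG.add w hw w' hw', star_add, dotProduct_add],
    fun c w hw => by rw [hG.smul c w hw, star_smul, dotProduct_smul, smul_eq_mul]⟩

theorem IsSesqOn.mul {F : V → ℂ} {G : W → ℂ} (hF : IsLinOn S F)
    (hG : IsLinOn R G) : IsSesqOn S R fun v w => F v * star (G w) where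
  left w _ := ⟨fun v hv v' hv' => by simp only [hF.add v hv v' hv', add_mul],
    fun c v hv => by simp only [hF.smul c v hv, smul_eq_mul, mul_assoc]⟩
  right v _ := ⟨fun w hw w' hw' => by rw [hG.add w hw w' hw', star_add, mul_add],
    fun c w hw => by rw [hG.smul c w hw, smul_eq_mul, star_mul', mul_left_comm]⟩

theorem IsAntilinOn.add' {f g : V → ℂ} (hf : IsAntilinOn S f) (hg : IsAntilinOn S g) :
    IsAntilinOn S fun v => f v + g v :=
  ⟨fun v hv v' hv' => by rw [hf.add v hv v' hv', hg.add v hv v' hv', add_add_add_comm],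
    fun c v hv => by rw [hf.smul c v hv, hg.smul c v hv, mul_add]⟩

theorem IsAntilinOn.neg {f : V → ℂ} (hf : IsAntilinOn S f) : IsAntilinOn S fun v => -f v :=
  ⟨fun v hv v' hv' => by rw [hf.add v hv v' hv', neg_add],
    fun c v hv => by rw [hf.smul c v hv, mul_neg]⟩

theorem IsAntilinOn.sum {ι : Type*} (s : Finset ι) {f : ι → V → ℂ}
    (hf : ∀ i ∈ s, IsAntilinOn S (f i)) : IsAntilinOn S fun v => ∑ i ∈ s, f i v :=
  ⟨fun v hv v' hv' => by
      rw [← Finset.sum_add_distrib]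
      exact Finset.sum_congr rfl fun i hi => (hf i hi).add v hv v' hv',
    fun c v hv => by
      rw [Finset.mul_sum]
      exact Finset.sum_congr rfl fun i hi => (hf i hi).smul c v hv⟩

theorem IsLinOn.add' {f g : V → ℂ} (hf : IsLinOn S f) (hg : IsLinOn S g) :
    IsLinOn S fun v => f v + g v :=
  ⟨fun v hv v' hv' => by rw [hf.add v hv v' hv', hg.add v hv v' hv', add_add_add_comm],
    fun c v hv => by rw [hf.smul c v hv, hg.smul c v hv, smul_add]⟩

theorem IsLinOn.neg {f : V → ℂ} (hf : IsLinOn S f) : IsLinOn S fun v => -f v :=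
  ⟨fun v hv v' hv' => by rw [hf.add v hv v' hv', neg_add],
    fun c v hv => by rw [hf.smul c v hv, smul_neg]⟩

theorem IsLinOn.sum {ι : Type*} (s : Finset ι) {f : ι → V → ℂ}
    (hf : ∀ i ∈ s, IsLinOn S (f i)) : IsLinOn S fun v => ∑ i ∈ s, f i v :=
  ⟨fun v hv v' hv' => by
      rw [← Finset.sum_add_distrib]
      exact Finset.sum_congr rfl fun i hi => (hf i hi).add v hv v' hv',
    fun c v hv => by
      rw [Finset.smul_sum]
      exact Finset.sum_congr rfl fun i hi => (hf i hi).smul c v hv⟩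

theorem IsSesqOn.add {f g : V → W → ℂ} (hf : IsSesqOn S R f) (hg : IsSesqOn S R g) :
    IsSesqOn S R fun v w => f v w + g v w :=
  ⟨fun w hw => (hf.left w hw).add' (hg.left w hw),
    fun v hv => (hf.right v hv).add' (hg.right v hv)⟩

theorem IsSesqOn.neg {f : V → W → ℂ} (hf : IsSesqOn S R f) :
    IsSesqOn S R fun v w => -f v w :=
  ⟨fun w hw => (hf.left w hw).neg, fun v hv => (hf.right v hv).neg⟩

theorem IsSesqOn.sub {f g : V → W → ℂ} (hf : IsSesqOn S R f) (hg : IsSesqOn S R g) :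
    IsSesqOn S R fun v w => f v w - g v w := by
  simpa only [sub_eq_add_neg] using hf.add hg.neg

theorem IsSesqOn.sum {ι : Type*} (s : Finset ι) {f : ι → V → W → ℂ}
    (hf : ∀ i ∈ s, IsSesqOn S R (f i)) : IsSesqOn S R fun v w => ∑ i ∈ s, f i v w :=
  ⟨fun w hw => .sum s fun i hi => (hf i hi).left w hw,
    fun v hv => .sum s fun i hi => (hf i hi).right v hv⟩

theorem IsSesqOn.const_mul {f : V → W → ℂ} (hf : IsSesqOn S R f) (a : ℂ) :
    IsSesqOn S R fun v w => a * f v w where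
  left w hw := ⟨fun v hv v' hv' => by simp only [(hf.left w hw).add v hv v' hv', mul_add],
    fun c v hv => by simp only [(hf.left w hw).smul c v hv, smul_eq_mul, mul_left_comm]⟩
  right v hv := ⟨fun w hw w' hw' => by simp only [(hf.right v hv).add w hw w' hw', mul_add],
    fun c w hw => by simp only [(hf.right v hv).smul c w hw, mul_left_comm]⟩

theorem IsAntilinOn.integral {α : Type*} [MeasurableSpace α] {ν : Measure α}
    {f : α → V → ℂ} (hf : ∀ x, IsAntilinOn S (f x))
    (hi : ∀ v ∈ S, Integrable (fun x => f x v) ν) :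
    IsAntilinOn S fun v => ∫ x, f x v ∂ν where
  add v hv v' hv' := by
    rw [← integral_add (hi v hv) (hi v' hv')]
    exact integral_congr_ae (.of_forall fun x => (hf x).add v hv v' hv')
  smul c v hv := by
    rw [← integral_const_mul]
    exact integral_congr_ae (.of_forall fun x => (hf x).smul c v hv)

theorem IsSesqOn.integral {α : Type*} [MeasurableSpace α] {ν : Measure α}
    {f : α → V → W → ℂ} (hf : ∀ x, IsSesqOn S R (f x))
    (hi : ∀ v ∈ S, ∀ w ∈ R, Integrable (fun x => f x v w) ν) :
    IsSesqOn S R fun v w => ∫ x, f x v w ∂ν where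
  left w hw :=
    { add := fun v hv v' hv' => by
        rw [← integral_add (hi v hv w hw) (hi v' hv' w hw)]
        exact integral_congr_ae (.of_forall fun x => ((hf x).left w hw).add v hv v' hv')
      smul := fun c v hv => by
        rw [← integral_smul]
        exact integral_congr_ae (.of_forall fun x => ((hf x).left w hw).smul c v hv) }
  right v hv := .integral (fun x => (hf x).right v hv) (hi v hv)

/-- A nondegenerate sesquilinear form on a finite-dimensional space represents every antilinear
functional. -/
theorem IsSesqOn.existsUnique_rep [FiniteDimensional ℂ S] {f : V → V → ℂ} (hf : IsSesqOn S S f)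
    (hnd : ∀ x ∈ S, (∀ y ∈ S, f x y = 0) → x = 0) {g : V → ℂ} (hg : IsAntilinOn S g) :
    ∃! x, x ∈ S ∧ ∀ y ∈ S, f x y = g y := by
  let b := Module.finBasis ℂ S
  -- Conjugation of coordinates in a basis. Composing with it turns antilinear functionals into
  -- linear ones, so that injectivity into the dual space, of equal dimension, gives surjectivity.
  let C : S → S := fun y => ∑ i, star (b.repr y i) • b i
  have hC_add (y z : S) : C (y + z) = C y + C z := by
    simp only [C, map_add, Finsupp.add_apply, star_add, add_smul, Finset.sum_add_distrib]
  have hC_smul (c : ℂ) (y : S) : C (c • y) = star c • C y := by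
    simp only [C, map_smul, Finsupp.smul_apply, smul_eq_mul, star_mul', mul_smul,
      Finset.smul_sum]
  have hC_C (y : S) : C (C y) = y := by
    have h (i) : b.repr (C y) i = star (b.repr y i) := by
      simp only [C, b.repr_sum_self]
    conv_lhs => simp only [C]
    simp only [C] at h
    simp only [h, star_star]
    exact b.sum_repr y
  let F : S →ₗ[ℂ] Module.Dual ℂ S := LinearMap.mk₂ ℂ (fun x y => f x (C y))
    (fun x x' y => (hf.left _ (C y).2).add x x.2 x' x'.2)
    (fun c x y => (hf.left _ (C y).2).smul c x x.2)
    (fun x y y' => by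
      rw [hC_add]
      exact (hf.right x x.2).add _ (C y).2 _ (C y').2)
    (fun c x y => by
      rw [hC_smul, Submodule.coe_smul, (hf.right x x.2).smul _ _ (C y).2, star_star, smul_eq_mul])
  have hinj : Function.Injective F := by
    refine (injective_iff_map_eq_zero F).2 fun x hx => ?_
    refine Subtype.ext (hnd x x.2 fun y hy => ?_)
    have := LinearMap.congr_fun hx (C ⟨y, hy⟩)
    simpa only [F, LinearMap.mk₂_apply, hC_C, LinearMap.zero_apply] using this
  have hsurj : Function.Surjective F :=
    (LinearMap.injective_iff_surjective_of_finrank_eq_finrank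
      (Subspace.dual_finrank_eq (K := ℂ) (V := S)).symm).1 hinj
  let G : Module.Dual ℂ S :=
    { toFun := fun y => g (C y)
      map_add' := fun y z => by
        rw [hC_add]
        exact hg.add _ (C y).2 _ (C z).2
      map_smul' := fun c y => by
        rw [hC_smul, Submodule.coe_smul, hg.smul _ _ (C y).2, star_star, RingHom.id_apply,
          smul_eq_mul] }
  obtain ⟨x, hx⟩ := hsurj G
  refine ⟨x, ⟨x.2, fun y hy => ?_⟩, fun z hz => ?_⟩
  · have := LinearMap.congr_fun hx (C ⟨y, hy⟩)
    simpa only [F, G, LinearMap.mk₂_apply, LinearMap.coe_mk, AddHom.coe_mk, hC_C] using this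
  · have : F ⟨z, hz.1⟩ = F x := by
      rw [hx]
      ext y
      exact hz.2 _ (C y).2
    exact congrArg Subtype.val (hinj this)

/-- The solution operator of a family of variational problems is linear. -/
theorem IsSesqOn.isLinOn_of_rep {f : X → X → ℂ} (hf : IsSesqOn Q Q f)
    (hnd : ∀ x ∈ Q, (∀ y ∈ Q, f x y = 0) → x = 0) {g : V → X → ℂ} (hg : IsSesqOn S Q g)
    {D : V → X} (hD : ∀ v ∈ S, D v ∈ Q ∧ ∀ y ∈ Q, f (D v) y = g v y) : IsLinOn S D := by
  have huniq : ∀ x ∈ Q, ∀ x' ∈ Q, (∀ y ∈ Q, f x y = f x' y) → x = x' := by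
    intro x hx x' hx' h
    have hneg := Q.smul_mem (-1) hx'
    have h0 : x + (-1 : ℂ) • x' = 0 := by
      refine hnd _ (Q.add_mem hx hneg) fun y hy => ?_
      rw [(hf.left y hy).add x hx _ hneg, (hf.left y hy).smul _ x' hx', h y hy, neg_one_smul,
        add_neg_cancel]
    rwa [neg_one_smul, ← sub_eq_add_neg, sub_eq_zero] at h0
  refine ⟨fun v hv v' hv' => ?_, fun c v hv => ?_⟩
  · obtain ⟨h1, h1'⟩ := hD v hv
    obtain ⟨h2, h2'⟩ := hD v' hv'
    obtain ⟨h3, h3'⟩ := hD _ (S.add_mem hv hv')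
    refine huniq _ h3 _ (Q.add_mem h1 h2) fun y hy => ?_
    rw [h3' y hy, (hf.left y hy).add _ h1 _ h2, (hg.left y hy).add v hv v' hv', h1' y hy, h2' y hy]
  · obtain ⟨h1, h1'⟩ := hD v hv
    obtain ⟨h3, h3'⟩ := hD _ (S.smul_mem c hv)
    refine huniq _ h3 _ (Q.smul_mem c h1) fun y hy => ?_
    rw [h3' y hy, (hf.left y hy).smul _ _ h1, (hg.left y hy).smul c v hv, h1' y hy]

theorem IsSesqOn.zero_left {f : V → W → ℂ} (hf : IsSesqOn S R f) {w : W} (hw : w ∈ R) :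
    f 0 w = 0 := by
  have := (hf.left w hw).smul 0 0 S.zero_mem
  simpa using this

theorem IsAntilinOn.map_zero {f : V → ℂ} (hf : IsAntilinOn S f) : f 0 = 0 := by
  have := hf.smul 0 0 S.zero_mem
  simpa using this

/-- Unique solvability of a finite-dimensional saddle point system from uniqueness. -/
theorem IsSesqOn.existsUnique_saddle [FiniteDimensional ℂ S] [FiniteDimensional ℂ R]
    {a : V → V → ℂ} {b : V → W → ℂ} (ha : IsSesqOn S S a) (hb : IsSesqOn S R b)
    (hnd : ∀ E ∈ S, ∀ p ∈ R, (∀ v ∈ S, a E v - star (b v p) = 0) → (∀ w ∈ R, b E w = 0) →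
      E = 0 ∧ p = 0) {f : V → ℂ} {g : W → ℂ} (hf : IsAntilinOn S f) (hg : IsAntilinOn R g) :
    ∃! x : V × W, x.1 ∈ S ∧ x.2 ∈ R ∧ (∀ v ∈ S, a x.1 v - star (b v x.2) = f v) ∧
      ∀ w ∈ R, b x.1 w = g w := by
  have hfin : FiniteDimensional ℂ (S.prod R) := by
    refine Module.Finite.iff_fg.2 (Submodule.FG.prod ?_ ?_)
    · exact Module.Finite.iff_fg.1 inferInstance
    · exact Module.Finite.iff_fg.1 inferInstance
  -- The two equations are added into one form on the product. Conjugating `b` makes the coupling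
  -- term linear in the unknown and antilinear in the test function.
  have hF : IsSesqOn (S.prod R) (S.prod R) fun x y : V × W =>
      a x.1 y.1 - star (b y.1 x.2) + b x.1 y.2 := by
    refine ⟨fun y hy => ⟨fun x hx x' hx' => ?_, fun c x hx => ?_⟩,
      fun x hx => ⟨fun y hy y' hy' => ?_, fun c y hy => ?_⟩⟩
    · simp only [Prod.fst_add, Prod.snd_add]
      rw [(ha.left _ hy.1).add _ hx.1 _ hx'.1, (hb.right _ hy.1).add _ hx.2 _ hx'.2,
        (hb.left _ hy.2).add _ hx.1 _ hx'.1, star_add]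
      ring
    · simp only [Prod.smul_fst, Prod.smul_snd]
      rw [(ha.left _ hy.1).smul _ _ hx.1, (hb.right _ hy.1).smul _ _ hx.2,
        (hb.left _ hy.2).smul _ _ hx.1, star_mul', star_star]
      simp only [smul_eq_mul]
      ring
    · simp only [Prod.fst_add, Prod.snd_add]
      rw [(ha.right _ hx.1).add _ hy.1 _ hy'.1, (hb.left _ hx.2).add _ hy.1 _ hy'.1,
        (hb.right _ hx.1).add _ hy.2 _ hy'.2, star_add]
      ring
    · simp only [Prod.smul_fst, Prod.smul_snd]
      rw [(ha.right _ hx.1).smul _ _ hy.1, (hb.left _ hx.2).smul _ _ hy.1,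
        (hb.right _ hx.1).smul _ _ hy.2, smul_eq_mul, star_mul']
      ring
  have hG : IsAntilinOn (S.prod R) fun y : V × W => f y.1 + g y.2 := by
    refine ⟨fun y hy y' hy' => ?_, fun c y hy => ?_⟩
    · simp only [Prod.fst_add, Prod.snd_add]
      rw [hf.add _ hy.1 _ hy'.1, hg.add _ hy.2 _ hy'.2, add_add_add_comm]
    · simp only [Prod.smul_fst, Prod.smul_snd]
      rw [hf.smul _ _ hy.1, hg.smul _ _ hy.2, mul_add]
  -- Test pairs `(v, 0)` and `(0, w)` recover the two equations from their sum.
  have key : ∀ x : V × W, x ∈ S.prod R → ∀ (f' : V → ℂ) (g' : W → ℂ), f' 0 = 0 → g' 0 = 0 →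
      ((∀ y ∈ S.prod R, a x.1 y.1 - star (b y.1 x.2) + b x.1 y.2 = f' y.1 + g' y.2) ↔
        (∀ v ∈ S, a x.1 v - star (b v x.2) = f' v) ∧ ∀ w ∈ R, b x.1 w = g' w) := by
    intro x hx f' g' hf' hg'
    refine ⟨fun h => ⟨fun v hv => ?_, fun w hw => ?_⟩, fun h y hy => ?_⟩
    · simpa [hg', (hb.right _ hx.1).map_zero] using h (v, 0) ⟨hv, R.zero_mem⟩
    · simpa [hf', (ha.right _ hx.1).map_zero, hb.zero_left hx.2] using h (0, w) ⟨S.zero_mem, hw⟩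
    · rw [h.1 _ hy.1, h.2 _ hy.2]
  obtain ⟨x, ⟨hx, hxe⟩, huniq⟩ := hF.existsUnique_rep (fun x hx h => by
    obtain ⟨h1, h2⟩ := (key x hx (fun _ => 0) (fun _ => 0) rfl rfl).1 (by simpa using h)
    obtain ⟨h3, h4⟩ := hnd x.1 hx.1 x.2 hx.2 h1 h2
    exact Prod.ext h3 h4) hG
  have hx' := (key x hx f g hf.map_zero hg.map_zero).1 hxe
  refine ⟨x, ⟨hx.1, hx.2, hx'.1, hx'.2⟩, fun y hy => huniq y ?_⟩
  have hyS : y ∈ S.prod R := ⟨hy.1, hy.2.1⟩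
  exact ⟨hyS, (key y hyS f g hf.map_zero hg.map_zero).2 hy.2.2⟩

end Sesquilinear

/-! ### Real symmetric matrices as Hermitian forms -/

section Quadratic

variable {m : ℕ}

/-- The value at a complex vector of the Hermitian form of a real symmetric matrix. -/
def quadVal (K : Matrix (Fin m) (Fin m) ℝ) (z : Fin m → ℂ) : ℝ :=
  (fun i => (z i).re) ⬝ᵥ K.mulVec (fun i => (z i).re) +
    (fun i => (z i).im) ⬝ᵥ K.mulVec (fun i => (z i).im)

/-- Symmetry cancels the cross terms between real and imaginary parts, so the form is real. -/
theorem toC_mulVec_dotProduct_star {K : Matrix (Fin m) (Fin m) ℝ} (hK : K.IsHermitian)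
    (z : Fin m → ℂ) : (toC K).mulVec z ⬝ᵥ star z = (quadVal K z : ℂ) := by
  have hre (i : Fin m) : ((toC K).mulVec z i).re = K.mulVec (fun i => (z i).re) i := by
    simp [Matrix.mulVec, dotProduct]
  have him (i : Fin m) : ((toC K).mulVec z i).im = K.mulVec (fun i => (z i).im) i := by
    simp [Matrix.mulVec, dotProduct]
  have hsymm : (fun i => (z i).re) ⬝ᵥ K.mulVec (fun i => (z i).im) =
      (fun i => (z i).im) ⬝ᵥ K.mulVec (fun i => (z i).re) := by
    have hT : K.transpose = K := by simpa using hK.eq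
    rw [Matrix.dotProduct_mulVec, ← Matrix.mulVec_transpose, hT, dotProduct_comm]
  apply Complex.ext
  · rw [Complex.ofReal_re, dotProduct, Complex.re_sum, quadVal]
    simp only [dotProduct, ← Finset.sum_add_distrib]
    refine Finset.sum_congr rfl fun i _ => ?_
    simp only [Pi.star_apply, Complex.star_def, Complex.mul_re, Complex.conj_re, Complex.conj_im,
      hre, him]
    ring
  · rw [Complex.ofReal_im, dotProduct, Complex.im_sum, ← sub_eq_zero.2 hsymm]
    simp only [dotProduct, ← Finset.sum_sub_distrib]
    refine Finset.sum_congr rfl fun i _ => ?_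
    simp only [Pi.star_apply, Complex.star_def, Complex.mul_im, Complex.conj_re, Complex.conj_im,
      hre, him]
    ring

theorem quadVal_nonneg {K : Matrix (Fin m) (Fin m) ℝ} (hK : K.PosDef) (z : Fin m → ℂ) :
    0 ≤ quadVal K z :=
  add_nonneg (by simpa using hK.posSemidef.dotProduct_mulVec_nonneg fun i => (z i).re)
    (by simpa using hK.posSemidef.dotProduct_mulVec_nonneg fun i => (z i).im)

theorem eq_zero_of_quadVal_eq_zero {K : Matrix (Fin m) (Fin m) ℝ} (hK : K.PosDef)
    {z : Fin m → ℂ} (h : quadVal K z = 0) : z = 0 := by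
  have h1 : 0 ≤ (fun i => (z i).re) ⬝ᵥ K.mulVec fun i => (z i).re := by
    simpa using hK.posSemidef.dotProduct_mulVec_nonneg fun i => (z i).re
  have h2 : 0 ≤ (fun i => (z i).im) ⬝ᵥ K.mulVec fun i => (z i).im := by
    simpa using hK.posSemidef.dotProduct_mulVec_nonneg fun i => (z i).im
  obtain ⟨h3, h4⟩ := (add_eq_zero_iff_of_nonneg h1 h2).1 h
  have hx : (fun i => (z i).re) = 0 := by
    by_contra hne
    exact (hK.dotProduct_mulVec_pos hne).ne' (by simpa using h3)
  have hy : (fun i => (z i).im) = 0 := by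
    by_contra hne
    exact (hK.dotProduct_mulVec_pos hne).ne' (by simpa using h4)
  funext i
  exact Complex.ext (congrFun hx i) (congrFun hy i)

theorem continuous_quadVal (K : Matrix (Fin m) (Fin m) ℝ) : Continuous (quadVal K) := by
  unfold quadVal
  refine .add (.dotProduct ?_ (.matrix_mulVec ?_ ?_)) (.dotProduct ?_ (.matrix_mulVec ?_ ?_)) <;>
    fun_prop

theorem dotProduct_star_eq_quadVal (z : Fin m → ℂ) :
    z ⬝ᵥ star z = (quadVal (1 : Matrix (Fin m) (Fin m) ℝ) z : ℂ) := by
  rw [← toC_mulVec_dotProduct_star Matrix.isHermitian_one]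
  simp [toC]

theorem toC_inv {K : Matrix (Fin m) (Fin m) ℝ} (hK : K.PosDef) : (toC K)⁻¹ = toC K⁻¹ := by
  refine Matrix.inv_eq_left_inv ?_
  have h : K⁻¹ * K = 1 := Matrix.nonsing_inv_mul K ((Matrix.isUnit_iff_isUnit_det K).1 hK.isUnit)
  have := congrArg (fun A : Matrix (Fin m) (Fin m) ℝ => A.map (Complex.ofRealHom)) h
  rw [Matrix.map_mul] at this
  refine this.trans ?_
  simp

/-- The Hermitian form of `(i ω ε + σ)⁻¹`, in terms of the image vector. -/
theorem admInv_mulVec_dotProduct_star {ω σ : ℝ} (hσ : 0 < σ) {ε : Matrix (Fin m) (Fin m) ℝ}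
    (hε : ε.PosDef) (z : Fin m → ℂ) :
    (admInv ω σ ε).mulVec z ⬝ᵥ star z =
      (σ : ℂ) * (quadVal 1 ((admInv ω σ ε).mulVec z) : ℂ)
        - Complex.I * ω * (quadVal ε ((admInv ω σ ε).mulVec z) : ℂ) := by
  set G : Matrix (Fin m) (Fin m) ℂ :=
    (Complex.I * (ω : ℂ)) • toC ε + (σ : ℂ) • (1 : Matrix (Fin m) (Fin m) ℂ) with hG
  have hGw (w : Fin m → ℂ) : G.mulVec w ⬝ᵥ star w =
      Complex.I * ω * (quadVal ε w : ℂ) + (σ : ℂ) * (quadVal 1 w : ℂ) := by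
    rw [hG, Matrix.add_mulVec, Matrix.smul_mulVec, Matrix.smul_mulVec, Matrix.one_mulVec,
      add_dotProduct, smul_dotProduct, smul_dotProduct, toC_mulVec_dotProduct_star hε.1,
      dotProduct_star_eq_quadVal, smul_eq_mul, smul_eq_mul]
  -- The real part of `(G w, w)` is `σ |w|²`, which makes `G` invertible.
  have hinj : Function.Injective G.mulVec := by
    refine (injective_iff_map_eq_zero (Matrix.mulVecLin G)).2 fun w hw => ?_
    have h0 : G.mulVec w = 0 := hw
    have h1 := hGw w
    rw [h0, zero_dotProduct] at h1
    have h2 := congrArg Complex.re h1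
    simp only [Complex.zero_re, Complex.add_re, Complex.mul_re, Complex.I_re, Complex.I_im,
      Complex.mul_im, Complex.ofReal_re, Complex.ofReal_im] at h2
    refine eq_zero_of_quadVal_eq_zero Matrix.PosDef.one ?_
    have h3 : σ * quadVal 1 w = 0 := by linarith
    exact (mul_eq_zero.1 h3).resolve_left hσ.ne'
  have hunit : IsUnit G.det :=
    (Matrix.isUnit_iff_isUnit_det G).1 (Matrix.mulVec_injective_iff_isUnit.1 hinj)
  have hz : z = G.mulVec ((admInv ω σ ε).mulVec z) := by
    rw [Matrix.mulVec_mulVec, admInv, Matrix.mul_nonsing_inv _ hunit, Matrix.one_mulVec]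
  set w := (admInv ω σ ε).mulVec z
  -- With `z = G w`, the product `(w, z)` is the conjugate of `(G w, w)`; this is where the minus
  -- sign before `I * ω` comes from.
  have h1 : w ⬝ᵥ star z = star (z ⬝ᵥ star w) := by
    rw [← Matrix.star_dotProduct_star, star_star, dotProduct_comm]
  rw [h1]
  conv_lhs => rw [hz]
  rw [hGw]
  simp only [star_add, star_mul', Complex.star_def, Complex.conj_I, Complex.conj_ofReal]
  ring

end Quadratic

/-! ### Integrals of nonnegative continuous functions -/

/-- Names the integral as a real number, so that the identity `a(v, v) = 0` can be split into real
and imaginary parts; continuity on an open set upgrades almost everywhere to everywhere. -/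
theorem Mesh.integral_ofReal_elem (M : Mesh d Ω) (hbdd : Bornology.IsBounded Ω) (T : M.elems)
    {q : Space d → ℝ} (hq : Continuous q) (h0 : ∀ x, 0 ≤ q x) :
    ∃ t : ℝ, 0 ≤ t ∧ ∫ x in (T : Set (Space d)), (q x : ℂ) = (t : ℂ) ∧
      (t = 0 → ∀ x ∈ (T : Set (Space d)), q x = 0) := by
  refine ⟨_, integral_nonneg h0, integral_complex_ofReal, fun h => ?_⟩
  have hint : IntegrableOn q (T : Set (Space d)) :=
    (hq.continuousOn.integrableOn_compact hbdd.isCompact_closure).mono_set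
      ((M.elem_subset T T.2).trans subset_closure)
  have := (setIntegral_eq_zero_iff_of_nonneg_ae (.of_forall h0) hint).1 h
  exact Measure.eqOn_open_of_ae_eq this (M.elem_isOpen T T.2) hq.continuousOn continuousOn_const

theorem Mesh.integral_ofReal_face (M : Mesh d Ω) (e : M.faces)
    {q : ↥(e : Set (Space d)) → ℝ} (hq : Continuous q) (h0 : ∀ x, 0 ≤ q x) :
    ∃ t : ℝ, 0 ≤ t ∧ ∫ x, (q x : ℂ) ∂surf (e : Set (Space d)) = (t : ℂ) ∧
      (t = 0 → ∀ x, q x = 0) := by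
  refine ⟨_, integral_nonneg h0, integral_complex_ofReal, fun h => ?_⟩
  have hint : Integrable q (surf (e : Set (Space d))) := by
    have := hq.continuousOn.integrableOn_compact (μ := surf (e : Set (Space d))) isCompact_univ
    rwa [integrableOn_univ] at this
  have := (integral_eq_zero_iff_of_nonneg h0 hint).1 h
  exact congrFun ((Continuous.ae_eq_iff_eq _ hq continuous_const).1 this)

theorem Mesh.integral_quadVal (M : Mesh d Ω) (hbdd : Bornology.IsBounded Ω) (T : M.elems) {m : ℕ}
    {K : Matrix (Fin m) (Fin m) ℝ} (hK : K.PosDef) {F : Space d → Fin m → ℂ}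
    (hF : Continuous F) :
    ∃ t : ℝ, 0 ≤ t ∧ ∫ x in (T : Set (Space d)), (quadVal K (F x) : ℂ) = (t : ℂ) ∧
      (t = 0 → ∀ x ∈ (T : Set (Space d)), F x = 0) := by
  obtain ⟨t, h0, h1, h2⟩ := M.integral_ofReal_elem hbdd T ((continuous_quadVal K).comp hF)
    fun x => quadVal_nonneg hK (F x)
  exact ⟨t, h0, h1, fun h x hx => eq_zero_of_quadVal_eq_zero hK (h2 h x hx)⟩

/-! ### The finite element spaces -/

/-- `V_h` as a submodule. -/
noncomputable def VhS (M : Mesh d Ω) (k : ℕ) : Submodule ℂ (WeakFun M) where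
  carrier := Vh M k
  add_mem' {v w} hv hw := ⟨fun T i => (P d k).add_mem (hv.1 T i) (hw.1 T i), fun e i => by
    obtain ⟨p, hp, hpv⟩ := hv.2 e i
    obtain ⟨q, hq, hqw⟩ := hw.2 e i
    refine ⟨p + q, (P d k).add_mem hp hq, fun x => ?_⟩
    simp [hpv, hqw, ev]⟩
  zero_mem' := ⟨fun T i => (P d k).zero_mem, fun e i => ⟨0, (P d k).zero_mem, fun x => by
    simp [ev]⟩⟩
  smul_mem' c v hv := ⟨fun T i => (P d k).smul_mem c (hv.1 T i), fun e i => by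
    obtain ⟨p, hp, hpv⟩ := hv.2 e i
    refine ⟨c • p, (P d k).smul_mem c hp, fun x => ?_⟩
    simp [hpv, ev]⟩

instance finiteDimensional_VhS (M : Mesh d Ω) (k : ℕ) : FiniteDimensional ℂ (VhS M k) := by
  -- Face components are functions, not polynomials. Different polynomials may agree on a face, so
  -- `Φ` need not be injective, but its range contains `V_h`.
  let Φ : ((M.elems → Fin d → P d k) × (M.faces → Fin d → P d k)) →ₗ[ℂ] WeakFun M :=
    { toFun := fun p => (fun T i => p.1 T i, fun e i x => ev (p.2 e i : Poly d) (x : Space d))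
      map_add' := fun p q => by
        ext <;> simp [ev]
      map_smul' := fun c p => by
        ext <;> simp [ev] }
  have hle : VhS M k ≤ LinearMap.range Φ := by
    intro v hv
    choose p hp hpv using hv.2
    exact ⟨(fun T i => ⟨v.1 T i, hv.1 T i⟩, fun e i => ⟨p e i, hp e i⟩),
      Prod.ext rfl (funext fun e => funext fun i => funext fun x => (hpv e i x).symm)⟩
  exact Submodule.finiteDimensional_of_le hle

/-! ### Cross products, curls, gradients and evaluations as linear maps -/

theorem cross_add (n v w : Fin d → ℂ) : cross d (v + w) n = cross d v n + cross d w n := by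
  match d with
  | 2 => exact funext fun (i : Fin 1) => match i with
    | 0 => by
      change (v 0 + w 0) * n 1 - (v 1 + w 1) * n 0 =
        v 0 * n 1 - v 1 * n 0 + (w 0 * n 1 - w 1 * n 0)
      ring
  | 3 => exact funext fun (i : Fin 3) => match i with
    | 0 => by
      change (v 1 + w 1) * n 2 - (v 2 + w 2) * n 1 =
        v 1 * n 2 - v 2 * n 1 + (w 1 * n 2 - w 2 * n 1)
      ring
    | 1 => by
      change (v 2 + w 2) * n 0 - (v 0 + w 0) * n 2 =
        v 2 * n 0 - v 0 * n 2 + (w 2 * n 0 - w 0 * n 2)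
      ring
    | 2 => by
      change (v 0 + w 0) * n 1 - (v 1 + w 1) * n 0 =
        v 0 * n 1 - v 1 * n 0 + (w 0 * n 1 - w 1 * n 0)
      ring
  | 0 | 1 | (_ + 4) => exact funext fun i => Fin.elim0 i

theorem cross_smul (c : ℂ) (n v : Fin d → ℂ) : cross d (c • v) n = c • cross d v n := by
  match d with
  | 2 => exact funext fun (i : Fin 1) => match i with
    | 0 => by
      change c * v 0 * n 1 - c * v 1 * n 0 = c * (v 0 * n 1 - v 1 * n 0)
      ring
  | 3 => exact funext fun (i : Fin 3) => match i with
    | 0 => by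
      change c * v 1 * n 2 - c * v 2 * n 1 = c * (v 1 * n 2 - v 2 * n 1)
      ring
    | 1 => by
      change c * v 2 * n 0 - c * v 0 * n 2 = c * (v 2 * n 0 - v 0 * n 2)
      ring
    | 2 => by
      change c * v 0 * n 1 - c * v 1 * n 0 = c * (v 0 * n 1 - v 1 * n 0)
      ring
  | 0 | 1 | (_ + 4) => exact funext fun i => Fin.elim0 i

/-- The cross product with a fixed vector, as a linear map. -/
noncomputable def crossL (d : ℕ) (n : Fin d → ℂ) : (Fin d → ℂ) →ₗ[ℂ] (Fin (curlDim d) → ℂ) where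
  toFun v := cross d v n
  map_add' v w := cross_add n v w
  map_smul' c v := cross_smul c n v

theorem polyCurl_add (φ ψ : Fin (curlDim d) → Poly d) :
    polyCurl d (φ + ψ) = polyCurl d φ + polyCurl d ψ := by
  have h (a b : Fin d) (x y z w : Poly d) :
      MvPolynomial.pderiv a (x + y) - MvPolynomial.pderiv b (z + w) =
        MvPolynomial.pderiv a x - MvPolynomial.pderiv b z +
          (MvPolynomial.pderiv a y - MvPolynomial.pderiv b w) := by
    rw [map_add, map_add]
    ring
  match d with
  | 2 =>
    let f : Fin 1 → Poly 2 := φ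
    let g : Fin 1 → Poly 2 := ψ
    exact funext fun i => match i with
      | 0 => map_add (MvPolynomial.pderiv 1) (f 0) (g 0)
      | 1 => (congrArg Neg.neg (map_add (MvPolynomial.pderiv 0) (f 0) (g 0))).trans
        (neg_add _ _)
  | 3 =>
    let f : Fin 3 → Poly 3 := φ
    let g : Fin 3 → Poly 3 := ψ
    exact funext fun i => match i with
      | 0 => h 1 2 (f 2) (g 2) (f 1) (g 1)
      | 1 => h 2 0 (f 0) (g 0) (f 2) (g 2)
      | 2 => h 0 1 (f 1) (g 1) (f 0) (g 0)
  | 0 | 1 | (_ + 4) => exact (add_zero (0 : Fin _ → Poly _)).symm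

theorem polyCurl_smul (c : ℂ) (φ : Fin (curlDim d) → Poly d) :
    polyCurl d (c • φ) = c • polyCurl d φ := by
  have h (a b : Fin d) (x y : Poly d) :
      MvPolynomial.pderiv a (c • x) - MvPolynomial.pderiv b (c • y) =
        c • (MvPolynomial.pderiv a x - MvPolynomial.pderiv b y) := by
    rw [Derivation.map_smul, Derivation.map_smul, smul_sub]
  match d with
  | 2 =>
    let f : Fin 1 → Poly 2 := φ
    exact funext fun i => match i with
      | 0 => Derivation.map_smul (MvPolynomial.pderiv 1) c (f 0)
      | 1 => (congrArg Neg.neg (Derivation.map_smul (MvPolynomial.pderiv 0) c (f 0))).trans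
        (smul_neg _ _).symm
  | 3 =>
    let f : Fin 3 → Poly 3 := φ
    exact funext fun i => match i with
      | 0 => h 1 2 (f 2) (f 1)
      | 1 => h 2 0 (f 0) (f 2)
      | 2 => h 0 1 (f 1) (f 0)
  | 0 | 1 | (_ + 4) => exact (smul_zero (A := Fin _ → Poly _) c).symm

/-- The curl of polynomial fields, as a linear map. -/
noncomputable def polyCurlL (d : ℕ) : (Fin (curlDim d) → Poly d) →ₗ[ℂ] (Fin d → Poly d) where
  toFun := polyCurl d
  map_add' := polyCurl_add
  map_smul' := polyCurl_smul

/-- The gradient of polynomials, as a linear map. -/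
noncomputable def gradL (d : ℕ) : Poly d →ₗ[ℂ] (Fin d → Poly d) :=
  LinearMap.pi fun i => (MvPolynomial.pderiv i).toLinearMap

/-- Evaluation of polynomial fields at a point, as a linear map. -/
noncomputable def evVecL {d m : ℕ} (x : Space d) : (Fin m → Poly d) →ₗ[ℂ] (Fin m → ℂ) :=
  LinearMap.pi fun i => (LinearMap.proj x ∘ₗ evL d) ∘ₗ LinearMap.proj i

/-- The value of `v₀|_T` at a point, as a linear map. -/
noncomputable def valL (M : Mesh d Ω) (T : M.elems) (x : Space d) : WeakFun M →ₗ[ℂ] (Fin d → ℂ) :=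
  (evVecL x ∘ₗ LinearMap.proj T) ∘ₗ LinearMap.fst ℂ _ _

/-- The value of `v_b|_e` at a point, as a linear map. -/
noncomputable def bdValL (M : Mesh d Ω) (e : M.faces) (x : ↥(e : Set (Space d))) :
    WeakFun M →ₗ[ℂ] (Fin d → ℂ) where
  toFun v := bdVal v e x
  map_add' _ _ := rfl
  map_smul' _ _ := rfl

/-- The scalar product with a fixed vector, as a linear map. -/
noncomputable def dotL {m : ℕ} (n : Fin m → ℂ) : (Fin m → ℂ) →ₗ[ℂ] ℂ where
  toFun v := v ⬝ᵥ n
  map_add' v w := add_dotProduct v w n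
  map_smul' c v := smul_dotProduct c v n

@[fun_prop]
theorem continuous_evVec {m : ℕ} (p : Fin m → Poly d) : Continuous (evVec p) :=
  continuous_pi fun i => continuous_ev (p i)

theorem continuous_bdVal {M : Mesh d Ω} {k : ℕ} {v : WeakFun M} (hv : v ∈ Vh M k) (e : M.faces) :
    Continuous (bdVal v e) := by
  refine continuous_pi fun i => ?_
  obtain ⟨p, -, hp⟩ := hv.2 e i
  have : (fun x => bdVal v e x i) = fun x : ↥(e : Set (Space d)) => ev p x := funext hp
  rw [this]
  exact (continuous_ev p).comp continuous_subtype_val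

theorem continuous_cross {α : Type*} [TopologicalSpace α] {f : α → Fin d → ℂ}
    (hf : Continuous f) (n : Fin d → ℂ) : Continuous fun x => cross d (f x) n := by
  exact (LinearMap.continuous_of_finiteDimensional (crossL d n)).comp hf

/-! ### The weak divergence and the weak curl -/

theorem Mesh.isSesqOn_mass (M : Mesh d Ω) (hbdd : Bornology.IsBounded Ω) (T : M.elems)
    (Q : Submodule ℂ (Poly d)) : IsSesqOn Q Q fun g φ =>
      ∫ x in (T : Set (Space d)), ev g x * star (ev φ x) :=
  .integral (fun x => .mul (isLinOn_linearMap (LinearMap.proj x ∘ₗ evL d) Q)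
      (isLinOn_linearMap (LinearMap.proj x ∘ₗ evL d) Q))
    fun g _ φ _ => M.integrableOn_elem hbdd T ((continuous_ev g).mul (continuous_ev φ).star)

theorem Mesh.isSesqOn_vecMass (M : Mesh d Ω) (hbdd : Bornology.IsBounded Ω) (T : M.elems) {m : ℕ}
    (Q : Submodule ℂ (Fin m → Poly d)) : IsSesqOn Q Q fun g φ =>
      ∫ x in (T : Set (Space d)), evVec g x ⬝ᵥ star (evVec φ x) :=
  .integral (fun x => .dot (isLinOn_linearMap (evVecL x) Q) (isLinOn_linearMap (evVecL x) Q))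
    fun g _ φ _ => M.integrableOn_elem hbdd T
      ((continuous_evVec g).dotProduct (continuous_evVec φ).star)

theorem Mesh.eq_zero_of_evVec (M : Mesh d Ω) (T : M.elems) {m : ℕ} {g : Fin m → Poly d}
    (h : ∀ x ∈ (T : Set (Space d)), evVec g x = 0) : g = 0 :=
  funext fun i => eq_zero_of_ev_eq_zero (M.elem_isOpen T T.2) (M.elem_isConnected T T.2).nonempty
    fun x hx => congrFun (h x hx) i

theorem Mesh.eq_zero_of_vecMass (M : Mesh d Ω) (hbdd : Bornology.IsBounded Ω) (T : M.elems)
    {m : ℕ} {g : Fin m → Poly d}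
    (h : ∫ x in (T : Set (Space d)), evVec g x ⬝ᵥ star (evVec g x) = 0) : g = 0 := by
  obtain ⟨t, -, ht, ht0⟩ := M.integral_quadVal hbdd T (Matrix.PosDef.one (n := Fin m) (R := ℝ))
    (continuous_evVec g)
  simp only [dotProduct_star_eq_quadVal] at h
  rw [h] at ht
  exact M.eq_zero_of_evVec T (ht0 (by exact_mod_cast ht.symm))

theorem Mesh.eq_zero_of_mass (M : Mesh d Ω) (hbdd : Bornology.IsBounded Ω) (T : M.elems)
    {g : Poly d} (h : ∫ x in (T : Set (Space d)), ev g x * star (ev g x) = 0) : g = 0 := by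
  have : (fun _ : Fin 1 => g) = 0 := M.eq_zero_of_vecMass hbdd T (by
    simpa [dotProduct, evVec] using h)
  exact congrFun this 0

theorem Mesh.isSesqOn_weakDiv_rhs (M : Mesh d Ω) (hbdd : Bornology.IsBounded Ω) (k : ℕ)
    (κ : M.elems → Matrix (Fin d) (Fin d) ℝ) (T : M.elems) (Q : Submodule ℂ (Poly d)) :
    IsSesqOn (VhS M k) Q fun v φ =>
      -(∫ x in (T : Set (Space d)), (toC (κ T)).mulVec (evVec (v.1 T) x) ⬝ᵥ
          star (evVec (fun i => MvPolynomial.pderiv i φ) x))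
      + ∑ e ∈ M.facesOf T, ∫ x : (e : Set (Space d)),
          (bdVal v e x ⬝ᵥ M.nrm T e) * star (ev φ x) ∂(surf (e : Set (Space d))) := by
  refine .add (.neg (.integral (fun x => .dot ?_ ?_) fun v _ φ _ => ?_))
    (.sum _ fun e _ => .integral (fun x => .mul ?_ ?_) fun v hv φ _ => ?_)
  · exact isLinOn_linearMap ((toC (κ T)).mulVecLin ∘ₗ valL M T x) _
  · exact isLinOn_linearMap (evVecL x ∘ₗ gradL d) Q
  · exact M.integrableOn_elem hbdd T (.dotProduct
      (continuous_const.matrix_mulVec (continuous_evVec _)) (continuous_evVec _).star)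
  · exact isLinOn_linearMap (dotL (M.nrm T e) ∘ₗ bdValL M e x) _
  · exact isLinOn_linearMap (LinearMap.proj (x : Space d) ∘ₗ evL d) Q
  · exact M.integrable_surf e (.mul ((continuous_bdVal hv e).dotProduct continuous_const)
      ((continuous_ev φ).comp continuous_subtype_val).star)

/-- The `L²` product is definite on `P_r(T)`, as polynomials vanishing on an open set are zero, so
it represents the antilinear right-hand side; the choice by `Classical.epsilon` is therefore a
genuine solution. -/
theorem weakDiv_spec (M : Mesh d Ω) (hbdd : Bornology.IsBounded Ω) {k : ℕ} (r : ℕ)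
    (κ : M.elems → Matrix (Fin d) (Fin d) ℝ) {v : WeakFun M} (hv : v ∈ Vh M k) (T : M.elems) :
    weakDiv M r κ v T ∈ P d r ∧ ∀ φ ∈ P d r,
      ∫ x in (T : Set (Space d)), ev (weakDiv M r κ v T) x * star (ev φ x) =
        -(∫ x in (T : Set (Space d)), (toC (κ T)).mulVec (evVec (v.1 T) x) ⬝ᵥ
          star (evVec (fun i => MvPolynomial.pderiv i φ) x))
        + ∑ e ∈ M.facesOf T, ∫ x : (e : Set (Space d)),
          (bdVal v e x ⬝ᵥ M.nrm T e) * star (ev φ x) ∂(surf (e : Set (Space d))) :=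
  Classical.epsilon_spec ((M.isSesqOn_mass hbdd T (P d r)).existsUnique_rep
    (fun g hg h => M.eq_zero_of_mass hbdd T (h g hg))
    ((M.isSesqOn_weakDiv_rhs hbdd k κ T (P d r)).right v hv)).exists

theorem isLinOn_weakDiv (M : Mesh d Ω) (hbdd : Bornology.IsBounded Ω) (k r : ℕ)
    (κ : M.elems → Matrix (Fin d) (Fin d) ℝ) (T : M.elems) :
    IsLinOn (VhS M k) fun v => weakDiv M r κ v T :=
  (M.isSesqOn_mass hbdd T (P d r)).isLinOn_of_rep
    (fun g hg h => M.eq_zero_of_mass hbdd T (h g hg)) (M.isSesqOn_weakDiv_rhs hbdd k κ T (P d r))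
    fun _ hv => weakDiv_spec M hbdd r κ hv T

/-- Polynomial fields of degree at most `r`. -/
noncomputable def polyField (d m r : ℕ) : Submodule ℂ (Fin m → Poly d) where
  carrier := {g | ∀ a, g a ∈ P d r}
  add_mem' hf hg a := (P d r).add_mem (hf a) (hg a)
  zero_mem' _ := (P d r).zero_mem
  smul_mem' c _ hf a := (P d r).smul_mem c (hf a)

instance finiteDimensional_polyField (d m r : ℕ) : FiniteDimensional ℂ (polyField d m r) := by
  let Φ : (Fin m → P d r) →ₗ[ℂ] (Fin m → Poly d) :=
    LinearMap.pi fun i => (P d r).subtype ∘ₗ LinearMap.proj i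
  have hle : polyField d m r ≤ LinearMap.range Φ := fun g hg => ⟨fun i => ⟨g i, hg i⟩, rfl⟩
  exact Submodule.finiteDimensional_of_le hle

theorem Mesh.isSesqOn_weakCurl_rhs (M : Mesh d Ω) (hbdd : Bornology.IsBounded Ω) (k : ℕ)
    (T : M.elems) (Q : Submodule ℂ (Fin (curlDim d) → Poly d)) :
    IsSesqOn (VhS M k) Q fun v φ =>
      (∫ x in (T : Set (Space d)), evVec (v.1 T) x ⬝ᵥ star (evVec (polyCurl d φ) x))
        - ∑ e ∈ M.facesOf T, ∫ x : (e : Set (Space d)),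
            cross d (bdVal v e x) (M.nrm T e) ⬝ᵥ star (evVec φ x) ∂(surf (e : Set (Space d))) := by
  refine .sub (.integral (fun x => .dot ?_ ?_) fun v _ φ _ => ?_)
    (.sum _ fun e _ => .integral (fun x => .dot ?_ ?_) fun v hv φ _ => ?_)
  · exact isLinOn_linearMap (valL M T x) _
  · exact isLinOn_linearMap (evVecL x ∘ₗ polyCurlL d) Q
  · exact M.integrableOn_elem hbdd T ((continuous_evVec _).dotProduct (continuous_evVec _).star)
  · exact isLinOn_linearMap (crossL d (M.nrm T e) ∘ₗ bdValL M e x) _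
  · exact isLinOn_linearMap (evVecL (x : Space d)) Q
  · exact M.integrable_surf e ((continuous_cross (continuous_bdVal hv e) _).dotProduct
      ((continuous_evVec φ).comp continuous_subtype_val).star)

theorem isLinOn_weakCurl (M : Mesh d Ω) (hbdd : Bornology.IsBounded Ω) (k r : ℕ) (T : M.elems) :
    IsLinOn (VhS M k) fun v => weakCurl M r v T := by
  have hnd : ∀ g ∈ polyField d (curlDim d) r, (∀ φ ∈ polyField d (curlDim d) r,
      ∫ x in (T : Set (Space d)), evVec g x ⬝ᵥ star (evVec φ x) = 0) → g = 0 :=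
    fun g hg h => M.eq_zero_of_vecMass hbdd T (h g hg)
  exact (M.isSesqOn_vecMass hbdd T (polyField d (curlDim d) r)).isLinOn_of_rep hnd
    (M.isSesqOn_weakCurl_rhs hbdd k T _) fun v hv =>
      Classical.epsilon_spec ((M.isSesqOn_vecMass hbdd T _).existsUnique_rep hnd
        ((M.isSesqOn_weakCurl_rhs hbdd k T _).right v hv)).exists

/-! ### Sesquilinearity of the forms -/

section Mono

variable {V W : Type*} [AddCommGroup V] [Module ℂ V] [AddCommGroup W] [Module ℂ W]
  {S S' : Submodule ℂ V} {R R' : Submodule ℂ W}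

theorem IsLinOn.mono {X : Type*} [AddCommGroup X] [Module ℂ X] {f : V → X} (hf : IsLinOn S f)
    (h : S' ≤ S) : IsLinOn S' f :=
  ⟨fun v hv v' hv' => hf.add v (h hv) v' (h hv'), fun c v hv => hf.smul c v (h hv)⟩

theorem IsAntilinOn.mono {f : V → ℂ} (hf : IsAntilinOn S f) (h : S' ≤ S) : IsAntilinOn S' f :=
  ⟨fun v hv v' hv' => hf.add v (h hv) v' (h hv'), fun c v hv => hf.smul c v (h hv)⟩

theorem IsSesqOn.mono {f : V → W → ℂ} (hf : IsSesqOn S R f) (hS : S' ≤ S) (hR : R' ≤ R) :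
    IsSesqOn S' R' f :=
  ⟨fun w hw => (hf.left w (hR hw)).mono hS, fun v hv => (hf.right v (hS hv)).mono hR⟩

end Mono

/-- `V_{h,0}^1` as a submodule. -/
noncomputable def Vh1S (M : Mesh d Ω) (k : ℕ) : Submodule ℂ (WeakFun M) where
  carrier := Vh1 M k
  add_mem' {v w} hv hw := ⟨(VhS M k).add_mem hv.1 hw.1, fun T e he heΓ x => by
    have : bdVal (v + w) e x = bdVal v e x + bdVal w e x := rfl
    rw [this, cross_add, hv.2 T e he heΓ x, hw.2 T e he heΓ x, add_zero]⟩
  zero_mem' := ⟨(VhS M k).zero_mem, fun T e _ _ x => (crossL d (M.nrm T e)).map_zero⟩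
  smul_mem' c v hv := ⟨(VhS M k).smul_mem c hv.1, fun T e he heΓ x => by
    have : bdVal (c • v) e x = c • bdVal v e x := rfl
    rw [this, cross_smul, hv.2 T e he heΓ x, smul_zero]⟩

/-- `V_{h,0}^2` as a submodule. -/
noncomputable def Vh2S (M : Mesh d Ω) (k : ℕ) : Submodule ℂ (WeakFun M) where
  carrier := Vh2 M k
  add_mem' {v w} hv hw := ⟨(VhS M k).add_mem hv.1 hw.1, fun T e he heΓ x => by
    have : bdVal (v + w) e x = bdVal v e x + bdVal w e x := rfl
    rw [this, add_dotProduct, hv.2 T e he heΓ x, hw.2 T e he heΓ x, add_zero]⟩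
  zero_mem' := ⟨(VhS M k).zero_mem, fun T e _ _ x => zero_dotProduct _⟩
  smul_mem' c v hv := ⟨(VhS M k).smul_mem c hv.1, fun T e he heΓ x => by
    have : bdVal (c • v) e x = c • bdVal v e x := rfl
    rw [this, smul_dotProduct, hv.2 T e he heΓ x, smul_zero]⟩

theorem Vh1S_le (M : Mesh d Ω) (k : ℕ) : Vh1S M k ≤ VhS M k := fun _ hv => hv.1

theorem Vh2S_le (M : Mesh d Ω) (k : ℕ) : Vh2S M k ≤ VhS M k := fun _ hv => hv.1

/-- `W_h^1` as a submodule. -/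
noncomputable def Wh1S (M : Mesh d Ω) (k : ℕ) : Submodule ℂ (M.elems → Poly d) where
  carrier := Wh1 M k
  add_mem' hp hq T := (P d (k - 1)).add_mem (hp T) (hq T)
  zero_mem' _ := (P d (k - 1)).zero_mem
  smul_mem' c _ hp T := (P d (k - 1)).smul_mem c (hp T)

/-- `W_h^2` as a submodule. -/
noncomputable def Wh2S (M : Mesh d Ω) (hbdd : Bornology.IsBounded Ω) (k : ℕ) :
    Submodule ℂ (M.elems → Poly d) where
  carrier := Wh2 M k
  add_mem' {p q} hp hq := ⟨(Wh1S M k).add_mem hp.1 hq.1, by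
    have (T : M.elems) : ∫ x in (T : Set (Space d)), ev ((p + q) T) x =
        (∫ x in (T : Set (Space d)), ev (p T) x) + ∫ x in (T : Set (Space d)), ev (q T) x := by
      rw [← integral_add (M.integrableOn_elem hbdd T (continuous_ev _))
        (M.integrableOn_elem hbdd T (continuous_ev _))]
      simp [ev]
    simp only [this, Finset.sum_add_distrib, hp.2, hq.2, add_zero]⟩
  zero_mem' := ⟨(Wh1S M k).zero_mem, by simp [ev]⟩
  smul_mem' c p hp := ⟨(Wh1S M k).smul_mem c hp.1, by
    have (T : M.elems) : ∫ x in (T : Set (Space d)), ev ((c • p) T) x =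
        c * ∫ x in (T : Set (Space d)), ev (p T) x := by
      rw [← integral_const_mul]
      simp [ev]
    simp only [this, ← Finset.mul_sum, hp.2, mul_zero]⟩

theorem Wh2S_le (M : Mesh d Ω) (hbdd : Bornology.IsBounded Ω) (k : ℕ) :
    Wh2S M hbdd k ≤ Wh1S M k := fun _ hp => hp.1

instance finiteDimensional_Wh1S (M : Mesh d Ω) (k : ℕ) : FiniteDimensional ℂ (Wh1S M k) := by
  let Φ : (M.elems → P d (k - 1)) →ₗ[ℂ] (M.elems → Poly d) :=
    LinearMap.pi fun i => (P d (k - 1)).subtype ∘ₗ LinearMap.proj i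
  have hle : Wh1S M k ≤ LinearMap.range Φ := fun g hg => ⟨fun i => ⟨g i, hg i⟩, rfl⟩
  exact Submodule.finiteDimensional_of_le hle

theorem isSesqOn_bulk (M : Mesh d Ω) (hbdd : Bornology.IsBounded Ω) (k : ℕ)
    (A : M.elems → Matrix (Fin (curlDim d)) (Fin (curlDim d)) ℂ)
    (B : M.elems → Matrix (Fin d) (Fin d) ℂ) :
    IsSesqOn (VhS M k) (VhS M k) (bulk M k A B) := by
  refine .sum _ fun T _ => .add (.integral (fun x => .dot ?_ ?_) fun v _ w _ => ?_)
    (.integral (fun x => .dot ?_ ?_) fun v _ w _ => ?_)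
  · exact (isLinOn_weakCurl M hbdd k (k - 1) T).linearMap_comp
      ((A T).mulVecLin ∘ₗ evVecL x)
  · exact (isLinOn_weakCurl M hbdd k (k - 1) T).linearMap_comp (evVecL x)
  · exact M.integrableOn_elem hbdd T (.dotProduct
      (continuous_const.matrix_mulVec (continuous_evVec _)) (continuous_evVec _).star)
  · exact isLinOn_linearMap ((B T).mulVecLin ∘ₗ valL M T x) _
  · exact isLinOn_linearMap (valL M T x) _
  · exact M.integrableOn_elem hbdd T (.dotProduct
      (continuous_const.matrix_mulVec (continuous_evVec _)) (continuous_evVec _).star)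

theorem continuous_normalResidual {M : Mesh d Ω} {k : ℕ} {v : WeakFun M} (hv : v ∈ Vh M k)
    (A : Matrix (Fin d) (Fin d) ℂ) (T : M.elems) (e : M.faces) :
    Continuous fun x : ↥(e : Set (Space d)) =>
      (A.mulVec (evVec (v.1 T) x) - bdVal v e x) ⬝ᵥ M.nrm T e :=
  .dotProduct (.sub (continuous_const.matrix_mulVec
    ((continuous_evVec _).comp continuous_subtype_val)) (continuous_bdVal hv e)) continuous_const

theorem continuous_tangentialResidual {M : Mesh d Ω} {k : ℕ} {v : WeakFun M} (hv : v ∈ Vh M k)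
    (T : M.elems) (e : M.faces) : Continuous fun x : ↥(e : Set (Space d)) =>
      cross d (evVec (v.1 T) x - bdVal v e x) (M.nrm T e) :=
  continuous_cross (.sub ((continuous_evVec _).comp continuous_subtype_val)
    (continuous_bdVal hv e)) _

theorem isSesqOn_stab (M : Mesh d Ω) (k : ℕ) (κ : M.elems → Matrix (Fin d) (Fin d) ℝ) :
    IsSesqOn (VhS M k) (VhS M k) (stab M κ) := by
  refine .sum _ fun T _ => .const_mul (.sum _ fun e _ => .add
    (.integral (fun x => .mul ?_ ?_) fun v hv w hw => ?_)
    (.integral (fun x => .dot ?_ ?_) fun v hv w hw => ?_)) _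
  · exact isLinOn_linearMap (dotL (M.nrm T e) ∘ₗ
      ((toC (κ T)).mulVecLin ∘ₗ valL M T x - bdValL M e x)) _
  · exact isLinOn_linearMap (dotL (M.nrm T e) ∘ₗ
      ((toC (κ T)).mulVecLin ∘ₗ valL M T x - bdValL M e x)) _
  · exact M.integrable_surf e ((continuous_normalResidual hv _ T e).mul
      (continuous_normalResidual hw _ T e).star)
  · exact isLinOn_linearMap (crossL d (M.nrm T e) ∘ₗ (valL M T x - bdValL M e x)) _
  · exact isLinOn_linearMap (crossL d (M.nrm T e) ∘ₗ (valL M T x - bdValL M e x)) _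
  · exact M.integrable_surf e ((continuous_tangentialResidual hv T e).dotProduct
      (continuous_tangentialResidual hw T e).star)

theorem isSesqOn_bForm (M : Mesh d Ω) (hbdd : Bornology.IsBounded Ω) (k : ℕ)
    (κ : M.elems → Matrix (Fin d) (Fin d) ℝ) : IsSesqOn (VhS M k) (Wh1S M k) (bForm M k κ) := by
  refine .sum _ fun T _ => .integral (fun x => .mul ?_ ?_) fun v _ q _ => ?_
  · exact (isLinOn_weakDiv M hbdd k (k - 1) κ T).linearMap_comp (LinearMap.proj x ∘ₗ evL d)
  · exact isLinOn_linearMap ((LinearMap.proj x ∘ₗ evL d) ∘ₗ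
      LinearMap.proj (φ := fun _ : M.elems => Poly d) T) _
  · exact M.integrableOn_elem hbdd T ((continuous_ev _).mul (continuous_ev _).star)

/-- On a bounded set, square integrable functions are integrable and polynomials are bounded. -/
theorem Mesh.integrableOn_mul_ev (M : Mesh d Ω) (hbdd : Bornology.IsBounded Ω) (T : M.elems)
    {f : Space d → ℂ} (hf : MemLp f 2 (volume.restrict Ω)) (p : Poly d) :
    IntegrableOn (fun x => f x * star (ev p x)) (T : Set (Space d)) := by
  have : IsFiniteMeasure (volume.restrict (T : Set (Space d))) :=
    ⟨by simpa using M.volume_elem_lt_top hbdd T⟩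
  have hfT : IntegrableOn f (T : Set (Space d)) :=
    (hf.mono_measure (Measure.restrict_mono (M.elem_subset T T.2) le_rfl)).integrable one_le_two
  obtain ⟨C, hC⟩ := hbdd.isCompact_closure.exists_bound_of_continuousOn
    (continuous_ev p).star.continuousOn
  refine Integrable.mul_bdd (c := C) hfT (continuous_ev p).star.aestronglyMeasurable ?_
  refine ae_restrict_of_forall_mem (M.elem_isOpen T T.2).measurableSet fun x hx => ?_
  exact hC x (subset_closure (M.elem_subset T T.2 hx))

theorem isAntilinOn_loadVec (M : Mesh d Ω) (hbdd : Bornology.IsBounded Ω)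
    {f : Space d → Fin d → ℂ} (hf : MemLp f 2 (volume.restrict Ω))
    (S : Submodule ℂ (WeakFun M)) : IsAntilinOn S (loadVec M f) := by
  refine .sum _ fun T _ => .integral (fun x => ?_) fun v _ => ?_
  · exact (IsSesqOn.dot (isLinOn_linearMap (LinearMap.id (R := ℂ) (M := Fin d → ℂ)) ⊤)
      (isLinOn_linearMap (valL M T x) S)).right (f x) trivial
  · refine integrable_finsetSum _ fun i _ => ?_
    exact M.integrableOn_mul_ev hbdd T
      ((ContinuousLinearMap.proj (R := ℂ) (φ := fun _ : Fin d => ℂ) i).comp_memLp' hf) _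

theorem isAntilinOn_loadScalar (M : Mesh d Ω) (hbdd : Bornology.IsBounded Ω)
    {ρ : Space d → ℂ} (hρ : MemLp ρ 2 (volume.restrict Ω))
    (R : Submodule ℂ (M.elems → Poly d)) : IsAntilinOn R (loadScalar M ρ) := by
  refine .sum _ fun T _ => .integral (fun x => ?_) fun q _ => M.integrableOn_mul_ev hbdd T hρ _
  exact (IsSesqOn.mul (isLinOn_linearMap (LinearMap.id (R := ℂ) (M := ℂ)) ⊤)
    (isLinOn_linearMap ((LinearMap.proj x ∘ₗ evL d) ∘ₗ
      LinearMap.proj (φ := fun _ : M.elems => Poly d) T) R)).right (ρ x) trivial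

/-! ### Normals -/

theorem Mesh.mem_facesOf (M : Mesh d Ω) {T : M.elems} {e : M.faces} :
    e ∈ M.facesOf T ↔ (e : Set (Space d)) ⊆ frontier (T : Set (Space d)) := by
  simp [Mesh.facesOf]

theorem Mesh.nrm_dotProduct_self (M : Mesh d Ω) {T : M.elems} {e : M.faces}
    (he : e ∈ M.facesOf T) : M.nrm T e ⬝ᵥ M.nrm T e = 1 := by
  have h := (M.normal_spec T T.2 e e.2 (M.mem_facesOf.1 he)).norm_eq_one
  have h2 : ∑ i, M.normal T e i * M.normal T e i = 1 := by
    have := EuclideanSpace.real_norm_sq_eq (M.normal T e)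
    rw [h] at this
    simp only [← sq]
    linarith
  simp only [dotProduct, Mesh.nrm]
  exact_mod_cast h2

theorem Mesh.nrm_eq_neg (M : Mesh d Ω) {T T' : M.elems} (hne : T ≠ T') {e : M.faces}
    (he : e ∈ M.facesOf T) (he' : e ∈ M.facesOf T') : M.nrm T' e = -M.nrm T e := by
  have := M.normal_eq_neg T.2 T'.2 (fun h => hne (Subtype.ext h)) e.2 (M.mem_facesOf.1 he)
    (M.mem_facesOf.1 he')
  funext i
  simp [Mesh.nrm, this]

theorem cross_self (n : Fin d → ℂ) : cross d n n = 0 := by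
  match d with
  | 2 => exact funext fun (i : Fin 1) => match i with
    | 0 => by
      change n 0 * n 1 - n 1 * n 0 = 0
      ring
  | 3 => exact funext fun (i : Fin 3) => match i with
    | 0 => by
      change n 1 * n 2 - n 2 * n 1 = 0
      ring
    | 1 => by
      change n 2 * n 0 - n 0 * n 2 = 0
      ring
    | 2 => by
      change n 0 * n 1 - n 1 * n 0 = 0
      ring
  | 0 | 1 | (_ + 4) => exact funext fun i => Fin.elim0 i

theorem Mesh.cross_nrm_nrm (M : Mesh d Ω) {T T' : M.elems} {e : M.faces}
    (he : e ∈ M.facesOf T) (he' : e ∈ M.facesOf T') : cross d (M.nrm T e) (M.nrm T' e) = 0 := by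
  by_cases h : T' = T
  · rw [h, cross_self]
  · rw [M.nrm_eq_neg h he' he, ← neg_one_smul ℂ, cross_smul, cross_self, smul_zero]

/-- The identity `(n ⬝ n) v = (v ⬝ n) n + n × (v × n)`, written in components. -/
theorem eq_zero_of_dot_of_cross (hd : d = 2 ∨ d = 3) {v n : Fin d → ℂ} (hn : n ⬝ᵥ n = 1)
    (h : v ⬝ᵥ n = 0) (h' : cross d v n = 0) : v = 0 := by
  rcases hd with rfl | rfl
  · have h0 : v 0 * n 1 - v 1 * n 0 = 0 := congrFun h' (0 : Fin 1)
    simp only [dotProduct, Fin.sum_univ_two] at hn h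
    funext i
    fin_cases i
    · change v 0 = 0
      linear_combination n 0 * h + n 1 * h0 - v 0 * hn
    · change v 1 = 0
      linear_combination n 1 * h - n 0 * h0 - v 1 * hn
  · have h0 : v 1 * n 2 - v 2 * n 1 = 0 := congrFun h' (0 : Fin 3)
    have h1 : v 2 * n 0 - v 0 * n 2 = 0 := congrFun h' (1 : Fin 3)
    have h2 : v 0 * n 1 - v 1 * n 0 = 0 := congrFun h' (2 : Fin 3)
    simp only [dotProduct, Fin.sum_univ_three] at hn h
    funext i
    fin_cases i
    · change v 0 = 0
      linear_combination n 0 * h + n 1 * h2 - n 2 * h1 - v 0 * hn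
    · change v 1 = 0
      linear_combination n 1 * h + n 2 * h0 - n 0 * h2 - v 1 * hn
    · change v 2 = 0
      linear_combination n 2 * h + n 0 * h1 - n 1 * h0 - v 2 * hn

/-! ### Definiteness of the forms -/

theorem stab_self (M : Mesh d Ω) (hd : 0 < d) (hbdd : Bornology.IsBounded Ω) {k : ℕ}
    (κ : M.elems → Matrix (Fin d) (Fin d) ℝ) {v : WeakFun M} (hv : v ∈ Vh M k) :
    ∃ s : ℝ, 0 ≤ s ∧ stab M κ v v = (s : ℂ) ∧ (s = 0 → ∀ (T : M.elems), ∀ e ∈ M.facesOf T,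
      ∀ x : ↥(e : Set (Space d)),
      ((toC (κ T)).mulVec (evVec (v.1 T) x) - bdVal v e x) ⬝ᵥ M.nrm T e = 0 ∧
      cross d (evVec (v.1 T) x - bdVal v e x) (M.nrm T e) = 0) := by
  choose f hf0 hf hfz using fun (T : M.elems) (e : M.faces) => M.integral_ofReal_face e
    (Complex.continuous_normSq.comp (continuous_normalResidual hv (toC (κ T)) T e))
    (fun x => Complex.normSq_nonneg _)
  choose g hg0 hg hgz using fun (T : M.elems) (e : M.faces) => M.integral_ofReal_face e
    ((continuous_quadVal 1).comp (continuous_tangentialResidual hv T e))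
    (fun x => quadVal_nonneg Matrix.PosDef.one _)
  have hsum (T : M.elems) : 0 ≤ ∑ e ∈ M.facesOf T, (f T e + g T e) :=
    Finset.sum_nonneg fun e _ => add_nonneg (hf0 T e) (hg0 T e)
  have hdiam (T : M.elems) := M.diam_pos hd hbdd T
  refine ⟨∑ T : M.elems, (Metric.diam (T : Set (Space d)))⁻¹ *
    ∑ e ∈ M.facesOf T, (f T e + g T e), ?_, ?_, fun h T e he x => ?_⟩
  · exact Finset.sum_nonneg fun T _ => mul_nonneg (inv_nonneg.2 (hdiam T).le) (hsum T)
  · simp only [stab, Complex.star_def, Complex.mul_conj, dotProduct_star_eq_quadVal]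
    push_cast
    refine Finset.sum_congr rfl fun T _ => ?_
    congr 1
    refine Finset.sum_congr rfl fun e _ => ?_
    rw [← hf T e, ← hg T e]
    rfl
  · have h1 := (Finset.sum_eq_zero_iff_of_nonneg fun T _ =>
      mul_nonneg (inv_nonneg.2 (hdiam T).le) (hsum T)).1 h T (Finset.mem_univ T)
    have h2 := (mul_eq_zero.1 h1).resolve_left (inv_ne_zero (hdiam T).ne')
    have h3 := (Finset.sum_eq_zero_iff_of_nonneg fun e _ =>
      add_nonneg (hf0 T e) (hg0 T e)).1 h2 e he
    obtain ⟨h4, h5⟩ := (add_eq_zero_iff_of_nonneg (hf0 T e) (hg0 T e)).1 h3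
    exact ⟨Complex.normSq_eq_zero.1 (hfz T e h4 x),
      eq_zero_of_quadVal_eq_zero Matrix.PosDef.one (hgz T e h5 x)⟩

/-- With zero interior part, the residuals reduce to `v_b ⬝ n` and `v_b × n` up to sign. Each face
has at least one element, and one normal suffices. -/
theorem eq_zero_of_interior_of_residuals (M : Mesh d Ω) (hd : d = 2 ∨ d = 3)
    (κ : M.elems → Matrix (Fin d) (Fin d) ℝ) {v : WeakFun M}
    (h0 : ∀ T : M.elems, ∀ x ∈ (T : Set (Space d)), evVec (v.1 T) x = 0)
    (h : ∀ (T : M.elems), ∀ e ∈ M.facesOf T,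
      ∀ x : ↥(e : Set (Space d)),
      ((toC (κ T)).mulVec (evVec (v.1 T) x) - bdVal v e x) ⬝ᵥ M.nrm T e = 0 ∧
      cross d (evVec (v.1 T) x - bdVal v e x) (M.nrm T e) = 0) : v = 0 := by
  have hv1 (T : M.elems) : v.1 T = 0 := M.eq_zero_of_evVec T (h0 T)
  refine Prod.ext (funext hv1) (funext fun e => funext fun i => funext fun x => ?_)
  obtain ⟨T, hT, heT⟩ := M.face_of_elem e e.2
  have he : e ∈ M.facesOf ⟨T, hT⟩ := M.mem_facesOf.2 heT
  obtain ⟨h1, h2⟩ := h ⟨T, hT⟩ e he x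
  have hz : evVec (v.1 ⟨T, hT⟩) (x : Space d) = 0 := by
    rw [hv1]
    exact (evVecL (x : Space d)).map_zero
  rw [hz, Matrix.mulVec_zero, zero_sub, neg_dotProduct, neg_eq_zero] at h1
  rw [hz, zero_sub, ← neg_one_smul ℂ, cross_smul, smul_eq_zero] at h2
  have h3 := h2.resolve_left (neg_ne_zero.2 one_ne_zero)
  exact congrFun (eq_zero_of_dot_of_cross hd (M.nrm_dotProduct_self he) h1 h3) i

theorem eq_zero_of_a1_self (M : Mesh d Ω) (hd : d = 2 ∨ d = 3) (hbdd : Bornology.IsBounded Ω)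
    {k : ℕ} {ω : ℝ} (hω : ω ≠ 0) {σ : M.elems → ℝ} (hσ : ∀ T, 0 < σ T)
    {ε : M.elems → Matrix (Fin d) (Fin d) ℝ}
    {μ : M.elems → Matrix (Fin (curlDim d)) (Fin (curlDim d)) ℝ} (hε : ∀ T, (ε T).PosDef)
    (hμ : ∀ T, (μ T).PosDef) {v : WeakFun M} (hv : v ∈ Vh M k)
    (h : a1 M k ω σ ε μ v v = 0) : v = 0 := by
  obtain ⟨s, hs0, hs, hsz⟩ := stab_self M (by omega) hbdd ε hv
  choose m hm0 hm hmz using fun T => M.integral_quadVal hbdd T (hμ T).inv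
    (continuous_evVec (weakCurl M (k - 1) v T))
  choose t ht0 ht htz using fun T => M.integral_quadVal hbdd T
    (Matrix.PosDef.one (n := Fin d) (R := ℝ)) (continuous_evVec (v.1 T))
  choose u hu0 hu huz using fun T => M.integral_quadVal hbdd T (hε T) (continuous_evVec (v.1 T))
  have hB (T : M.elems) : ∫ x in (T : Set (Space d)),
      ((Complex.I * (ω : ℂ) * (σ T : ℂ)) • (1 : Matrix (Fin d) (Fin d) ℂ)
        - ((ω : ℂ) ^ 2) • toC (ε T)).mulVec (evVec (v.1 T) x) ⬝ᵥ star (evVec (v.1 T) x) =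
      Complex.I * ω * σ T * t T - ω ^ 2 * u T := by
    rw [← ht, ← hu, ← integral_const_mul, ← integral_const_mul, ← integral_sub]
    · refine integral_congr_ae (.of_forall fun x => ?_)
      simp only [Matrix.sub_mulVec, Matrix.smul_mulVec, Matrix.one_mulVec, sub_dotProduct,
        smul_dotProduct, toC_mulVec_dotProduct_star (hε T).1, dotProduct_star_eq_quadVal,
        smul_eq_mul]
    all_goals
      exact M.integrableOn_elem hbdd T (continuous_const.mul (Complex.continuous_ofReal.comp
        ((continuous_quadVal _).comp (continuous_evVec _))))
  have hA (T : M.elems) : ∫ x in (T : Set (Space d)),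
      ((toC (μ T))⁻¹).mulVec (evVec (weakCurl M (k - 1) v T) x) ⬝ᵥ
        star (evVec (weakCurl M (k - 1) v T) x) = m T := by
    rw [toC_inv (hμ T), ← hm]
    simp only [toC_mulVec_dotProduct_star (hμ T).inv.1]
  rw [a1, bulk, hs] at h
  simp only [hA, hB] at h
  have him := congrArg Complex.im h
  have hre := congrArg Complex.re h
  simp only [Complex.add_im, Complex.im_sum, Complex.sub_im, Complex.ofReal_im, Complex.mul_im,
    Complex.mul_re, Complex.I_re, Complex.I_im, Complex.ofReal_re, Complex.zero_im, zero_mul,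
    one_mul, mul_zero, sub_zero, zero_add, add_zero, ← Complex.ofReal_pow] at him
  simp only [Complex.add_re, Complex.re_sum, Complex.sub_re, Complex.ofReal_im, Complex.mul_im,
    Complex.mul_re, Complex.I_re, Complex.I_im, Complex.ofReal_re, Complex.zero_re, zero_mul,
    one_mul, mul_zero, sub_zero, zero_add, zero_sub, ← Complex.ofReal_pow] at hre
  -- In the imaginary part only the conductivity term survives, and its sum has nonnegative terms.
  have ht1 (T : M.elems) : t T = 0 := by
    have h1 : ω * ∑ T, σ T * t T = 0 := by
      rw [Finset.mul_sum]
      simpa only [mul_assoc] using him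
    have h2 := (Finset.sum_eq_zero_iff_of_nonneg fun T _ =>
      mul_nonneg (hσ T).le (ht0 T)).1 ((mul_eq_zero.1 h1).resolve_left hω) T (Finset.mem_univ T)
    exact (mul_eq_zero.1 h2).resolve_left (hσ T).ne'
  have hv0 (T : M.elems) := htz T (ht1 T)
  have hu1 (T : M.elems) : u T = 0 := by
    have : (u T : ℂ) = 0 := by
      rw [← hu T]
      refine setIntegral_eq_zero_of_forall_eq_zero fun x hx => ?_
      rw [hv0 T x hx]
      simp [quadVal]
    exact_mod_cast this
  -- With `u = 0` the indefinite term is gone, and the real part is a sum of nonnegative quantities.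
  have hs1 : s = 0 := by
    have hm1 : 0 ≤ ∑ T, m T := Finset.sum_nonneg fun T _ => hm0 T
    simp only [hu1, mul_zero, add_zero, neg_zero] at hre
    linarith
  exact eq_zero_of_interior_of_residuals M hd ε hv0 (hsz hs1)

theorem eq_zero_of_a2_self (M : Mesh d Ω) (hd : d = 2 ∨ d = 3) (hbdd : Bornology.IsBounded Ω)
    {k : ℕ} {ω : ℝ} (hω : ω ≠ 0) {σ : M.elems → ℝ} (hσ : ∀ T, 0 < σ T)
    {ε : M.elems → Matrix (Fin (curlDim d)) (Fin (curlDim d)) ℝ}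
    {μ : M.elems → Matrix (Fin d) (Fin d) ℝ} (hε : ∀ T, (ε T).PosDef)
    (hμ : ∀ T, (μ T).PosDef) {v : WeakFun M} (hv : v ∈ Vh M k)
    (h : a2 M k ω σ ε μ v v = 0) : v = 0 := by
  obtain ⟨s, hs0, hs, hsz⟩ := stab_self M (by omega) hbdd μ hv
  have hcont (T : M.elems) : Continuous fun x =>
      (admInv ω (σ T) (ε T)).mulVec (evVec (weakCurl M (k - 1) v T) x) :=
    continuous_const.matrix_mulVec (continuous_evVec _)
  choose m hm0 hm hmz using fun T => M.integral_quadVal hbdd T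
    (Matrix.PosDef.one (n := Fin (curlDim d)) (R := ℝ)) (hcont T)
  choose u hu0 hu huz using fun T => M.integral_quadVal hbdd T (hε T) (hcont T)
  choose t ht0 ht htz using fun T => M.integral_quadVal hbdd T (hμ T) (continuous_evVec (v.1 T))
  have hA (T : M.elems) : ∫ x in (T : Set (Space d)),
      (admInv ω (σ T) (ε T)).mulVec (evVec (weakCurl M (k - 1) v T) x) ⬝ᵥ
        star (evVec (weakCurl M (k - 1) v T) x) = σ T * m T - Complex.I * ω * u T := by
    rw [← hm, ← hu, ← integral_const_mul, ← integral_const_mul, ← integral_sub]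
    · exact integral_congr_ae (.of_forall fun x =>
        admInv_mulVec_dotProduct_star (hσ T) (hε T) _)
    all_goals
      exact M.integrableOn_elem hbdd T (continuous_const.mul (Complex.continuous_ofReal.comp
        ((continuous_quadVal _).comp (hcont T))))
  have hB (T : M.elems) : ∫ x in (T : Set (Space d)),
      ((Complex.I * (ω : ℂ)) • toC (μ T)).mulVec (evVec (v.1 T) x) ⬝ᵥ star (evVec (v.1 T) x) =
      Complex.I * ω * t T := by
    rw [← ht, ← integral_const_mul]
    simp only [Matrix.smul_mulVec, smul_dotProduct, toC_mulVec_dotProduct_star (hμ T).1,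
      smul_eq_mul]
  rw [a2, bulk, hs] at h
  simp only [hA, hB] at h
  have him := congrArg Complex.im h
  have hre := congrArg Complex.re h
  simp only [Complex.add_im, Complex.im_sum, Complex.sub_im, Complex.ofReal_im, Complex.mul_im,
    Complex.mul_re, Complex.I_re, Complex.I_im, Complex.ofReal_re, Complex.zero_im, zero_mul,
    one_mul, mul_zero, sub_zero, zero_add, add_zero, zero_sub] at him
  simp only [Complex.add_re, Complex.re_sum, Complex.sub_re, Complex.ofReal_im, Complex.mul_im,
    Complex.mul_re, Complex.I_re, Complex.I_im, Complex.ofReal_re, Complex.zero_re, zero_mul,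
    one_mul, mul_zero, sub_zero, zero_add, add_zero] at hre
  have hsum : 0 ≤ ∑ T, σ T * m T := Finset.sum_nonneg fun T _ => mul_nonneg (hσ T).le (hm0 T)
  -- The real part comes first here: the imaginary part contains `-u` and `t` with opposite signs
  -- and is useless until `u = 0`.
  have hs1 : s = 0 := by linarith
  have hm1 (T : M.elems) : m T = 0 := by
    have h2 := (Finset.sum_eq_zero_iff_of_nonneg fun T _ =>
      mul_nonneg (hσ T).le (hm0 T)).1 (by linarith) T (Finset.mem_univ T)
    exact (mul_eq_zero.1 h2).resolve_left (hσ T).ne'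
  -- Both `m` and `u` are integrals of quadratic forms of the same image vector, so `m = 0` also
  -- removes `u`.
  have hu1 (T : M.elems) : u T = 0 := by
    have : (u T : ℂ) = 0 := by
      rw [← hu T]
      refine setIntegral_eq_zero_of_forall_eq_zero fun x hx => ?_
      rw [hmz T (hm1 T) x hx]
      simp [quadVal]
    exact_mod_cast this
  have ht1 (T : M.elems) : t T = 0 := by
    have h1 : ω * ∑ T, t T = 0 := by
      rw [Finset.mul_sum]
      simpa only [hu1, mul_zero, neg_zero, zero_add] using him
    exact (Finset.sum_eq_zero_iff_of_nonneg fun T _ => ht0 T).1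
      ((mul_eq_zero.1 h1).resolve_left hω) T (Finset.mem_univ T)
  exact eq_zero_of_interior_of_residuals M hd μ (fun T => htz T (ht1 T)) (hsz hs1)

/-! ### Nondegeneracy of the coupling form -/

/-- The weak function whose only nonzero part is the interior gradient of `p`. -/
noncomputable def gradFun (M : Mesh d Ω) (p : M.elems → Poly d) : WeakFun M :=
  (fun T i => MvPolynomial.pderiv i (p T), 0)

open Classical in
/-- The weak function whose only nonzero part is the constant `n` on the face `e`. -/
noncomputable def faceFun (M : Mesh d Ω) (e : M.faces) (n : Fin d → ℂ) : WeakFun M :=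
  (0, fun e' i _ => if e' = e then n i else 0)

open Classical in
theorem bdVal_faceFun (M : Mesh d Ω) (e e' : M.faces) (n : Fin d → ℂ)
    (x : ↥(e' : Set (Space d))) : bdVal (faceFun M e n) e' x = if e' = e then n else 0 := by
  funext i
  by_cases h : e' = e <;> simp [bdVal, faceFun, h]

theorem gradFun_mem_Vh {M : Mesh d Ω} {k : ℕ} {p : M.elems → Poly d} (hp : p ∈ Wh1 M k) :
    gradFun M p ∈ Vh M k := by
  refine ⟨fun T i => ?_, (VhS M k).zero_mem.2⟩
  have := pderiv_mem_P (hp T) i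
  rw [MvPolynomial.mem_restrictTotalDegree] at this ⊢
  exact this.trans (Nat.sub_le k 1)

theorem gradFun_mem_Vh1 {M : Mesh d Ω} {k : ℕ} {p : M.elems → Poly d} (hp : p ∈ Wh1 M k) :
    gradFun M p ∈ Vh1 M k :=
  ⟨gradFun_mem_Vh hp, (Vh1S M k).zero_mem.2⟩

theorem gradFun_mem_Vh2 {M : Mesh d Ω} {k : ℕ} {p : M.elems → Poly d} (hp : p ∈ Wh1 M k) :
    gradFun M p ∈ Vh2 M k :=
  ⟨gradFun_mem_Vh hp, (Vh2S M k).zero_mem.2⟩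

theorem faceFun_mem_Vh (M : Mesh d Ω) (k : ℕ) (e : M.faces) (n : Fin d → ℂ) :
    faceFun M e n ∈ Vh M k := by
  classical
  refine ⟨(VhS M k).zero_mem.1, fun e' i =>
    ⟨MvPolynomial.C (if e' = e then n i else 0), ?_, fun x => ?_⟩⟩
  · rw [MvPolynomial.mem_restrictTotalDegree, MvPolynomial.totalDegree_C]
    exact Nat.zero_le k
  · simp [faceFun, ev]

/-- A normal field has no tangential part, so it is admissible even on faces in `Γ`. This is why no
mean value condition is needed in (E). -/
theorem faceFun_nrm_mem_Vh1 (M : Mesh d Ω) (k : ℕ) {e : M.faces} {T : M.elems}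
    (he : e ∈ M.facesOf T) : faceFun M e (M.nrm T e) ∈ Vh1 M k := by
  classical
  refine ⟨faceFun_mem_Vh M k e _, fun T' e' he' _ x => ?_⟩
  rw [bdVal_faceFun]
  split_ifs with h
  · subst h
    exact M.cross_nrm_nrm he he'
  · exact (crossL d (M.nrm T' e')).map_zero

theorem faceFun_mem_Vh2 (M : Mesh d Ω) (k : ℕ) {e : M.faces}
    (he : ¬(e : Set (Space d)) ⊆ frontier Ω) (n : Fin d → ℂ) : faceFun M e n ∈ Vh2 M k := by
  classical
  refine ⟨faceFun_mem_Vh M k e _, fun T' e' he' heΓ x => ?_⟩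
  rw [bdVal_faceFun, if_neg, zero_dotProduct]
  rintro rfl
  exact he heΓ

/-- Since `p` is itself an admissible test polynomial of degree `k - 1`, the defining identity
removes the weak divergence from `b(v, p)`. -/
theorem bForm_eq (M : Mesh d Ω) (hbdd : Bornology.IsBounded Ω) {k : ℕ}
    (κ : M.elems → Matrix (Fin d) (Fin d) ℝ) {v : WeakFun M} (hv : v ∈ Vh M k)
    {p : M.elems → Poly d} (hp : p ∈ Wh1 M k) :
    bForm M k κ v p = ∑ T : M.elems,
      (-(∫ x in (T : Set (Space d)), (toC (κ T)).mulVec (evVec (v.1 T) x) ⬝ᵥ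
          star (evVec (fun i => MvPolynomial.pderiv i (p T)) x))
        + ∑ e ∈ M.facesOf T, ∫ x : (e : Set (Space d)),
          (bdVal v e x ⬝ᵥ M.nrm T e) * star (ev (p T) x) ∂(surf (e : Set (Space d)))) :=
  Finset.sum_congr rfl fun T _ => (weakDiv_spec M hbdd (k - 1) κ hv T).2 (p T) (hp T)

/-- For `v = {∇p, 0}` the face terms vanish and `b(v, p) = -∑ (κ ∇p, ∇p)`. -/
theorem exists_const_of_bForm_gradFun (M : Mesh d Ω) (hbdd : Bornology.IsBounded Ω) {k : ℕ}
    {κ : M.elems → Matrix (Fin d) (Fin d) ℝ} (hκ : ∀ T, (κ T).PosDef)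
    {p : M.elems → Poly d} (hp : p ∈ Wh1 M k) (h : bForm M k κ (gradFun M p) p = 0) :
    ∃ c : M.elems → ℂ, ∀ T, p T = MvPolynomial.C (c T) := by
  choose t ht0 ht htz using fun T => M.integral_quadVal hbdd T (hκ T)
    (continuous_evVec fun i => MvPolynomial.pderiv i (p T))
  have hb : bForm M k κ (gradFun M p) p = ∑ T : M.elems, -(t T : ℂ) := by
    rw [bForm_eq M hbdd κ (gradFun_mem_Vh hp) hp]
    refine Finset.sum_congr rfl fun T _ => ?_
    have h0 (e : M.faces) (x : ↥(e : Set (Space d))) : bdVal (gradFun M p) e x = 0 := rfl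
    simp only [h0, zero_dotProduct, zero_mul, integral_zero, Finset.sum_const_zero, add_zero]
    simp only [gradFun, toC_mulVec_dotProduct_star (hκ T).1, ht]
  rw [hb, Finset.sum_neg_distrib, neg_eq_zero] at h
  have h1 : ∑ T, t T = 0 := by exact_mod_cast h
  refine ⟨fun T => MvPolynomial.coeff 0 (p T), fun T => eq_C_of_pderiv_eq_zero fun i => ?_⟩
  have h2 := (Finset.sum_eq_zero_iff_of_nonneg fun T _ => ht0 T).1 h1 T (Finset.mem_univ T)
  exact congrFun (M.eq_zero_of_evVec T (htz T h2)) i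

theorem Mesh.surf_real_univ_pos (M : Mesh d Ω) (e : M.faces) :
    0 < (surf (e : Set (Space d))).real Set.univ := by
  have : Nonempty ↥(e : Set (Space d)) := (M.face_flat e e.2).nonempty.to_subtype
  exact ENNReal.toReal_pos (isOpen_univ.measure_pos _ Set.univ_nonempty).ne' (measure_ne_top _ _)

open Classical in
theorem bForm_faceFun (M : Mesh d Ω) (hbdd : Bornology.IsBounded Ω) {k : ℕ}
    (κ : M.elems → Matrix (Fin d) (Fin d) ℝ) {p : M.elems → Poly d} (hp : p ∈ Wh1 M k)
    {c : M.elems → ℂ} (hc : ∀ T, p T = MvPolynomial.C (c T)) (e : M.faces) (n : Fin d → ℂ) :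
    bForm M k κ (faceFun M e n) p = ∑ T : M.elems, if e ∈ M.facesOf T then
      ((surf (e : Set (Space d))).real Set.univ : ℂ) * ((n ⬝ᵥ M.nrm T e) * star (c T)) else 0 := by
  rw [bForm_eq M hbdd κ (faceFun_mem_Vh M k e n) hp]
  refine Finset.sum_congr rfl fun T _ => ?_
  have h0 (x : Space d) : evVec ((faceFun M e n).1 T) x = 0 := (evVecL x).map_zero
  have h1 (x : Space d) : ev (p T) x = c T := by simp [hc, ev]
  simp only [h0, Matrix.mulVec_zero, zero_dotProduct, integral_zero, neg_zero, zero_add, h1,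
    bdVal_faceFun, integral_const]
  have h2 (e' : M.faces) : (surf (e' : Set (Space d))).real Set.univ •
      ((if e' = e then n else 0) ⬝ᵥ M.nrm T e' * star (c T)) = if e' = e then
        ((surf (e : Set (Space d))).real Set.univ : ℂ) * ((n ⬝ᵥ M.nrm T e) * star (c T)) else 0 := by
    split_ifs with h
    · rw [h, Complex.real_smul]
    · rw [zero_dotProduct, zero_mul, smul_zero]
  simp only [h2, Finset.sum_ite_eq']

/-- Exactly two elements contain the face and their normals are opposite, so the form is the area of
the face times the conjugate jump of `c`. -/
theorem eq_of_bForm_faceFun (M : Mesh d Ω) (hbdd : Bornology.IsBounded Ω) {k : ℕ}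
    (κ : M.elems → Matrix (Fin d) (Fin d) ℝ) {p : M.elems → Poly d} (hp : p ∈ Wh1 M k)
    {c : M.elems → ℂ} (hc : ∀ T, p T = MvPolynomial.C (c T)) {T T' : M.elems} (hne : T ≠ T')
    {e : M.faces} (he : e ∈ M.facesOf T) (he' : e ∈ M.facesOf T')
    (h : bForm M k κ (faceFun M e (M.nrm T e)) p = 0) : c T = c T' := by
  classical
  rw [bForm_faceFun M hbdd κ hp hc, Finset.sum_eq_add T T' hne, if_pos he, if_pos he',
    M.nrm_eq_neg hne he he', dotProduct_neg, M.nrm_dotProduct_self he, one_mul, neg_one_mul,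
    ← mul_add, mul_eq_zero] at h
  · have h1 := h.resolve_left (by exact_mod_cast (M.surf_real_univ_pos e).ne')
    rw [← sub_eq_add_neg, sub_eq_zero] at h1
    exact star_injective h1
  · intro S _ hS
    rw [if_neg]
    intro heS
    rcases M.eq_or_eq_of_subset_frontier T.2 T'.2 S.2 (fun h => hne (Subtype.ext h)) e.2
      (M.mem_facesOf.1 he) (M.mem_facesOf.1 he') (M.mem_facesOf.1 heS) with h | h
    · exact hS.1 (Subtype.ext h)
    · exact hS.2 (Subtype.ext h)
  · exact fun h => absurd (Finset.mem_univ _) h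
  · exact fun h => absurd (Finset.mem_univ _) h

theorem eq_of_bForm_eq_zero (M : Mesh d Ω) (hΩ : IsOpen Ω) (hbdd : Bornology.IsBounded Ω)
    (hconn : IsConnected Ω) {k : ℕ} (κ : M.elems → Matrix (Fin d) (Fin d) ℝ)
    {p : M.elems → Poly d} (hp : p ∈ Wh1 M k) {c : M.elems → ℂ}
    (hc : ∀ T, p T = MvPolynomial.C (c T))
    (h : ∀ (T : M.elems) (e : M.faces), e ∈ M.facesOf T → ¬(e : Set (Space d)) ⊆ frontier Ω →
      bForm M k κ (faceFun M e (M.nrm T e)) p = 0) (T T' : M.elems) : c T = c T' := by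
  refine M.eq_of_forall_face_eq hΩ hconn c (fun S S' hne e he hS hS' heΓ => ?_) T T'
  have heS : (⟨e, he⟩ : M.faces) ∈ M.facesOf S := M.mem_facesOf.2 hS
  exact eq_of_bForm_faceFun M hbdd κ hp hc hne heS (M.mem_facesOf.2 hS') (h S _ heS heΓ)

theorem Mesh.nonempty_elems (M : Mesh d Ω) (hne : Ω.Nonempty) : Nonempty M.elems := by
  obtain ⟨x, hx⟩ := hne
  have := subset_closure hx
  rw [M.closure_eq] at this
  obtain ⟨T, hT, -⟩ := Set.mem_iUnion₂.1 this
  exact ⟨⟨T, hT⟩⟩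

theorem eq_zero_of_bForm_Vh1 (M : Mesh d Ω) (hd : 0 < d) (hΩ : IsOpen Ω)
    (hbdd : Bornology.IsBounded Ω) (hconn : IsConnected Ω) {k : ℕ}
    {κ : M.elems → Matrix (Fin d) (Fin d) ℝ} (hκ : ∀ T, (κ T).PosDef)
    {p : M.elems → Poly d} (hp : p ∈ Wh1 M k) (h : ∀ v ∈ Vh1 M k, bForm M k κ v p = 0) :
    p = 0 := by
  classical
  obtain ⟨c, hc⟩ := exists_const_of_bForm_gradFun M hbdd hκ hp (h _ (gradFun_mem_Vh1 hp))
  have hcc := eq_of_bForm_eq_zero M hΩ hbdd hconn κ hp hc fun T e he _ =>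
    h _ (faceFun_nrm_mem_Vh1 M k he)
  obtain ⟨T₀⟩ := M.nonempty_elems hconn.nonempty
  -- A face in `Γ` would not do: on a slit, the contributions of the two sides cancel. A face with
  -- one element leaves a single nonzero multiple of the constant.
  obtain ⟨e, he, S, hS, heS, huniq⟩ := M.exists_face_of_unique_elem hd hbdd T₀
  have heS' : (⟨e, he⟩ : M.faces) ∈ M.facesOf ⟨S, hS⟩ := M.mem_facesOf.2 heS
  have h1 := h _ (faceFun_nrm_mem_Vh1 M k heS')
  rw [bForm_faceFun M hbdd κ hp hc, Finset.sum_eq_single_of_mem ⟨S, hS⟩ (Finset.mem_univ _),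
    if_pos heS', M.nrm_dotProduct_self heS', one_mul, mul_eq_zero] at h1
  · have h2 := star_eq_zero.1
      (h1.resolve_left (by exact_mod_cast (M.surf_real_univ_pos ⟨e, he⟩).ne'))
    funext T
    rw [hc T, hcc T ⟨S, hS⟩, h2, MvPolynomial.C_0, Pi.zero_apply]
  · intro S' _ hne
    rw [if_neg]
    exact fun heS' => hne (Subtype.ext (huniq S' S'.2 (M.mem_facesOf.1 heS')))

theorem eq_zero_of_bForm_Vh2 (M : Mesh d Ω) (hΩ : IsOpen Ω)
    (hbdd : Bornology.IsBounded Ω) (hconn : IsConnected Ω) {k : ℕ}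
    {κ : M.elems → Matrix (Fin d) (Fin d) ℝ} (hκ : ∀ T, (κ T).PosDef)
    {p : M.elems → Poly d} (hp : p ∈ Wh2 M k) (h : ∀ v ∈ Vh2 M k, bForm M k κ v p = 0) :
    p = 0 := by
  obtain ⟨c, hc⟩ := exists_const_of_bForm_gradFun M hbdd hκ hp.1 (h _ (gradFun_mem_Vh2 hp.1))
  have hcc := eq_of_bForm_eq_zero M hΩ hbdd hconn κ hp.1 hc fun T e _ heΓ =>
    h _ (faceFun_mem_Vh2 M k heΓ _)
  obtain ⟨T₀⟩ := M.nonempty_elems hconn.nonempty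
  have hev (T : M.elems) (x : Space d) : ev (p T) x = c T₀ := by simp [hc T, hcc T T₀, ev]
  have h1 := hp.2
  -- The mean value of the constant is the constant times the total volume of the elements.
  simp only [hev, integral_const, Complex.real_smul, ← Finset.sum_mul] at h1
  have hvol (T : M.elems) : 0 < (volume.restrict (T : Set (Space d))).real Set.univ := by
    rw [measureReal_restrict_apply_univ]
    exact ENNReal.toReal_pos ((M.elem_isOpen T T.2).measure_pos volume
      (M.elem_isConnected T T.2).nonempty).ne' (M.volume_elem_lt_top hbdd T).ne
  have hsum : 0 < ∑ T : M.elems, (volume.restrict (T : Set (Space d))).real Set.univ :=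
    Finset.sum_pos (fun T _ => hvol T) ⟨T₀, Finset.mem_univ _⟩
  have h2 : c T₀ = 0 := (mul_eq_zero.1 h1).resolve_left (by exact_mod_cast hsum.ne')
  funext T
  rw [hc T, hcc T T₀, h2, MvPolynomial.C_0, Pi.zero_apply]

end WGMaxwell

/-! ### Unique solvability of the two systems -/

open WGMaxwell in
theorem mainTheorem3 (d : ℕ) (hd : d = 2 ∨ d = 3) (Ω : Set (WGMaxwell.Space d))
    (hΩ_open : IsOpen Ω) (hΩ_bdd : Bornology.IsBounded Ω) (hΩ_conn : IsConnected Ω)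
    (M : WGMaxwell.Mesh d Ω) (k : ℕ) (hk : 1 ≤ k) (ω : ℝ) (hω : ω ≠ 0)
    (σ : M.elems → ℝ) (hσ : ∀ T, 0 < σ T) :
    (∀ (ε : M.elems → Matrix (Fin d) (Fin d) ℝ)
        (μ : M.elems → Matrix (Fin (WGMaxwell.curlDim d)) (Fin (WGMaxwell.curlDim d)) ℝ),
      (∀ T, (ε T).PosDef) → (∀ T, (μ T).PosDef) →
      ∀ (j : WGMaxwell.Space d → Fin d → ℂ) (ρ : WGMaxwell.Space d → ℂ),
        MemLp j 2 (volume.restrict Ω) → MemLp ρ 2 (volume.restrict Ω) →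
        ∃! Ep : WGMaxwell.WeakFun M × (M.elems → WGMaxwell.Poly d),
          WGMaxwell.IsElectricSolution M k ω σ ε μ j ρ Ep.1 Ep.2) ∧
    (∀ (ε : M.elems → Matrix (Fin (WGMaxwell.curlDim d)) (Fin (WGMaxwell.curlDim d)) ℝ)
        (μ : M.elems → Matrix (Fin d) (Fin d) ℝ),
      (∀ T, (ε T).PosDef) → (∀ T, (μ T).PosDef) →
      ∀ (j : WGMaxwell.Space d → Fin (WGMaxwell.curlDim d) → ℂ)
        (g : WGMaxwell.Space d → Fin d → ℂ),
        MemLp j 2 (volume.restrict Ω) → MemLp g 2 (volume.restrict Ω) →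
        WGMaxwell.IsDistribCurl Ω
          (WGMaxwell.pwMul M (fun T => WGMaxwell.admInv ω (σ T) (ε T)) j) g →
        ∃! Hp : WGMaxwell.WeakFun M × (M.elems → WGMaxwell.Poly d),
          WGMaxwell.IsMagneticSolution M k ω σ ε μ g Hp.1 Hp.2) := by
  refine ⟨fun ε μ hε hμ j ρ hj hρ => ?_, fun ε μ hε hμ j g _ hg _ => ?_⟩
  · have hfin : FiniteDimensional ℂ (Vh1S M k) :=
      Submodule.finiteDimensional_of_le (Vh1S_le M k)
    have ha : IsSesqOn (Vh1S M k) (Vh1S M k) (a1 M k ω σ ε μ) :=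
      ((isSesqOn_bulk M hΩ_bdd k _ _).add (isSesqOn_stab M k ε)).mono (Vh1S_le M k) (Vh1S_le M k)
    have hb : IsSesqOn (Vh1S M k) (Wh1S M k) (bForm M k ε) :=
      (isSesqOn_bForm M hΩ_bdd k ε).mono (Vh1S_le M k) le_rfl
    obtain ⟨x, hx, huniq⟩ := ha.existsUnique_saddle hb (fun E hE p hp h1 h2 => by
        have hE0 : E = 0 := by
          refine eq_zero_of_a1_self M hd hΩ_bdd hω hσ hε hμ hE.1 ?_
          -- Testing with the solution itself: the second equation with `w = p` removes the coupling
          -- term.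
          simpa only [h2 p hp, star_zero, sub_zero] using h1 E hE
        subst hE0
        refine ⟨rfl, eq_zero_of_bForm_Vh1 M (by omega) hΩ_open hΩ_bdd hΩ_conn hε hp fun v hv => ?_⟩
        simpa only [ha.zero_left hv, zero_sub, neg_eq_zero, star_eq_zero] using h1 v hv)
      (isAntilinOn_loadVec M hΩ_bdd (hj.const_smul (Complex.I * (ω : ℂ))) _).neg
      (isAntilinOn_loadScalar M hΩ_bdd hρ _)
    exact ⟨x, ⟨hx.1, hx.2.1, hx.2.2.1, hx.2.2.2⟩, fun y hy =>
      huniq y ⟨hy.mem_V, hy.mem_W, hy.eq_field, hy.eq_div⟩⟩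
  · have hfin : FiniteDimensional ℂ (Vh2S M k) :=
      Submodule.finiteDimensional_of_le (Vh2S_le M k)
    have hfin' : FiniteDimensional ℂ (Wh2S M hΩ_bdd k) :=
      Submodule.finiteDimensional_of_le (Wh2S_le M hΩ_bdd k)
    have ha : IsSesqOn (Vh2S M k) (Vh2S M k) (a2 M k ω σ ε μ) :=
      ((isSesqOn_bulk M hΩ_bdd k _ _).add (isSesqOn_stab M k μ)).mono (Vh2S_le M k) (Vh2S_le M k)
    have hb : IsSesqOn (Vh2S M k) (Wh2S M hΩ_bdd k) (bForm M k μ) :=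
      (isSesqOn_bForm M hΩ_bdd k μ).mono (Vh2S_le M k) (Wh2S_le M hΩ_bdd k)
    obtain ⟨x, hx, huniq⟩ := ha.existsUnique_saddle hb (g := fun _ => 0)
      (fun H hH p hp h1 h2 => by
        have hH0 : H = 0 := by
          refine eq_zero_of_a2_self M hd hΩ_bdd hω hσ hε hμ hH.1 ?_
          simpa only [h2 p hp, star_zero, sub_zero] using h1 H hH
        subst hH0
        refine ⟨rfl, eq_zero_of_bForm_Vh2 M hΩ_open hΩ_bdd hΩ_conn hμ hp fun v hv => ?_⟩
        simpa only [ha.zero_left hv, zero_sub, neg_eq_zero, star_eq_zero] using h1 v hv)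
      (isAntilinOn_loadVec M hΩ_bdd hg _)
      ⟨fun _ _ _ _ => (add_zero 0).symm, fun _ _ _ => (mul_zero _).symm⟩
    exact ⟨x, ⟨hx.1, hx.2.1, hx.2.2.1, hx.2.2.2⟩, fun y hy =>
      huniq y ⟨hy.mem_V, hy.mem_W, hy.eq_field, hy.eq_div⟩⟩
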